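/- Fix real numbers $a,b>0$ and, in the plane with coordinates $(x,y)$, let $D=\{x=a,\ 0<y<b\}$, $A_0=D\cup\{0<x<a\}$, $B_0=D\cup\{x>a\}$, $A_1=A_0\cap\{y>0\}$, $B_1=B_0\cap\{y>0\}$, $B_2=B_0\cap\{y<b\}$, $B_3=B_0\cap\{0<y<b\}$. For $i\in\{0,1\}$ and $j\in\{0,1,2,3\}$ let $C_{ij}=A_i\cup B_j$, and let $R_{ij}$ be the set of all open rectangles $R$ in the plane (of arbitrary position and positive side lengths) that can move around the corner in the corridor $C_{ij}$, i.e. for which there is a continuous path $(\Phi_t)_{t\in[0,1]}$ in the Euclidean group $E(2)$ of rigid motions of the plane with $\Phi_0(R)\subset A_i$, $\Phi_1(R)\subset B_j$ and $\Phi_t(R)\subset C_{ij}$ for all $t\in[0,1]$. Put $a\wedge b=\min\{a,b\}$, $a\vee b=\max\{a,b\}$, $h=ab/\sqrt{a^2+b^2}$ and $m(a,b,c)=\min_{t\in[0,\pi/2]}\,(a\sin t+b\cos t-c\sin t\cos t)$. Then $R_{00}=R_{01}=R_{02}$, $R_{10}=R_{12}$, $R_{11}=R_{13}$, $R_{00}=R_{10}\cup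 R_{03}$ and $R_{13}=R_{10}\cap R_{03}$. Moreover, an open rectangle with side lengths $c\ge d>0$ belongs to the set (i) $R_{0j}$, $j=0,1,2$, if and only if $d\le a\wedge b$ and $cd\le ab$; (ii) $R_{03}$ if and only if ($h\le d\le a\wedge b$ and $cd\le ab$) or $d\le h\wedge m(a,b,c)$; (iii) $R_{1j}$, $j=0,2$, if and only if ($d\le h$ and $cd\le ab$), or ($h\le d\le a\wedge b$ and $c\le a\vee b$), or $h\le d\le m(a,b,c)$; (iv) $R_{1j}$, $j=1,3$, if and only if ($c\le a\vee b$ and $d\le a\wedge b$) or $d\le m(a,b,c)$. -/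

import Mathlib

open Real Set

noncomputable section

/-- The Euclidean plane; `p 0` and `p 1` are the coordinates `x` and `y` of the point `p`. -/
abbrev Plane : Type := EuclideanSpace ℝ (Fin 2)

/-- The open segment `D = {x = a, 0 < y < b}` through which the two arms communicate. -/
def doorSet (a b : ℝ) : Set Plane := {p | p 0 = a ∧ 0 < p 1 ∧ p 1 < b}

/-- `A₀ = D ∪ {0 < x < a}`. -/
def armA0 (a b : ℝ) : Set Plane := doorSet a b ∪ {p | 0 < p 0 ∧ p 0 < a}

/-- `A₁ = A₀ ∩ {y > 0}`. -/
def armA1 (a b : ℝ) : Set Plane := armA0 a b ∩ {p | 0 < p 1}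

/-- `B₀ = D ∪ {x > a}`. -/
def armB0 (a b : ℝ) : Set Plane := doorSet a b ∪ {p | a < p 0}

/-- `B₁ = B₀ ∩ {y > 0}`. -/
def armB1 (a b : ℝ) : Set Plane := armB0 a b ∩ {p | 0 < p 1}

/-- `B₂ = B₀ ∩ {y < b}`. -/
def armB2 (a b : ℝ) : Set Plane := armB0 a b ∩ {p | p 1 < b}

/-- `B₃ = B₀ ∩ {0 < y < b}`. -/
def armB3 (a b : ℝ) : Set Plane := armB0 a b ∩ {p | 0 < p 1 ∧ p 1 < b}

/-- The arms `A₀, A₁`, as an indexed family. -/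
def armA (a b : ℝ) (i : Fin 2) : Set Plane := ![armA0 a b, armA1 a b] i

/-- The arms `B₀, B₁, B₂, B₃`, as an indexed family. -/
def armB (a b : ℝ) (j : Fin 4) : Set Plane :=
  ![armB0 a b, armB1 a b, armB2 a b, armB3 a b] j

/-- The corridor `Cᵢⱼ = Aᵢ ∪ Bⱼ`. -/
def corridor (a b : ℝ) (i : Fin 2) (j : Fin 4) : Set Plane := armA a b i ∪ armB a b j

/-- `R` is an open rectangle with side lengths `c` and `d`: both are positive, and `R` is
congruent to `(0, c) × (0, d)`. -/
def IsOpenRectangle (c d : ℝ) (R : Set Plane) : Prop :=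
  0 < c ∧ 0 < d ∧ ∃ g : Plane ≃ᵃⁱ[ℝ] Plane,
    R = g '' {p : Plane | (0 < p 0 ∧ p 0 < c) ∧ (0 < p 1 ∧ p 1 < d)}

/-- `Φ` is a continuous path, parametrized by `[0, 1]`, in the Euclidean group `E(2)` of rigid
motions of the plane. The topology of `E(2)` is that of pointwise convergence. -/
def IsMotionPath (Φ : unitInterval → (Plane ≃ᵃⁱ[ℝ] Plane)) : Prop :=
  ∀ p : Plane, Continuous fun t => Φ t p

/-- The set `Rᵢⱼ` of the open rectangles that can move around the corner in the corridor
`Cᵢⱼ`, that is, be moved from `Aᵢ` to `Bⱼ` inside `Cᵢⱼ`. -/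
def movableRectangles (a b : ℝ) (i : Fin 2) (j : Fin 4) : Set (Set Plane) :=
  {R | (∃ c d : ℝ, IsOpenRectangle c d R) ∧
    ∃ Φ : unitInterval → (Plane ≃ᵃⁱ[ℝ] Plane), IsMotionPath Φ ∧
      Φ 0 '' R ⊆ armA a b i ∧ Φ 1 '' R ⊆ armB a b j ∧ ∀ t, Φ t '' R ⊆ corridor a b i j}

/-- `f(t) = a sin t + b cos t - c sin t cos t`. -/
def cornerFun (a b c t : ℝ) : ℝ := a * sin t + b * cos t - c * sin t * cos t

/-- `m(a, b, c) = min f` over `[0, π/2]`. -/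
def cornerMin (a b c : ℝ) : ℝ := sInf (cornerFun a b c '' Icc 0 (π / 2))

/-- The infimum defining `m(a, b, c)` is a minimum. -/
theorem cornerMin_isLeast (a b c : ℝ) :
    IsLeast (cornerFun a b c '' Icc 0 (π / 2)) (cornerMin a b c) := by
  have hc : Continuous (cornerFun a b c) := by unfold cornerFun; fun_prop
  exact (isCompact_Icc.image hc).isLeast_sInf
    ((nonempty_Icc.2 (by positivity)).image _)

/-- `h = ab / √(a² + b²)`. -/
def cornerHeight (a b : ℝ) : ℝ := a * b / √(a ^ 2 + b ^ 2)

end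

/-! A motion is recorded by the centre of the rectangle and the unit direction of its sides of
length `c`. Write `C, S ≥ 0` for the absolute coordinates of that direction. Everything turns on the
corner inequality `d ≤ a S + b C - c S C`; by `le_cornerMin_iff`, `d ≤ m(a, b, c)` says that it
holds at every tilt. The number `h` enters through `d ≤ h ↔ (d/a)² + (d/b)² ≤ 1`: given `c d ≤ a b`,
the corner inequality follows from `(a S - d)(d - b C) ≥ 0` (`corner_key`), and the position of `d`
relative to `h` decides at which tilts this sign condition is available (`corner_of_low`,
`corner_of_high`).

Necessity. The area bound comes from a moment when the line of the door meets the central part of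
the rectangle, where all vertical chords have the same maximal length; this length is then at most
`b` (`chord_bound`, `area_le_of_canMove`). If the corner inequality fails at some tilt `(C₀, S₀)`,
then `width_le_of_crossing` rules out the position in which the rectangle would have to pass that
tilt. An intermediate value or connectedness argument shows that this position cannot be avoided:
`corner_of_canMove_quadrant`, `corner_of_canMove_halfPlane`, `corner_of_canMove_strip`.

Sufficiency. A rectangle with `c ≤ a ∨ b` and `d ≤ a ∧ b` is translated through the door. A longer
one is turned with one corner on `x = 0` and its lower side passing through `(a, 0)`, then pushed
along its own direction (`canMove_of_pivotRect`). Only the condition `y < b` has to be checked, and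
each corridor demands it on a different part of the rectangle. The reflection `y ↦ b - y` transfers
the result to arms bounded on the other side. -/

noncomputable section

/-! ### Motions in terms of centre and direction -/

/-- The open rectangle with centre `(z₁, z₂)` whose sides of length `c` have direction `(u₁, u₂)`
and whose other sides have length `d`. -/
def tiltedRect (c d z₁ z₂ u₁ u₂ : ℝ) : Set Plane :=
  {p | ∃ s r : ℝ, |s| < c / 2 ∧ |r| < d / 2 ∧
    p 0 = z₁ + s * u₁ - r * u₂ ∧ p 1 = z₂ + s * u₂ + r * u₁}

/-- A `c × d` rectangle can be moved from `A` to `B` inside `A ∪ B`. -/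
def CanMove (c d : ℝ) (A B : Set Plane) : Prop :=
  ∃ z₁ z₂ u₁ u₂ : unitInterval → ℝ,
    Continuous z₁ ∧ Continuous z₂ ∧ Continuous u₁ ∧ Continuous u₂ ∧
    (∀ t, u₁ t ^ 2 + u₂ t ^ 2 = 1) ∧
    tiltedRect c d (z₁ 0) (z₂ 0) (u₁ 0) (u₂ 0) ⊆ A ∧
    tiltedRect c d (z₁ 1) (z₂ 1) (u₁ 1) (u₂ 1) ⊆ B ∧
    ∀ t, tiltedRect c d (z₁ t) (z₂ t) (u₁ t) (u₂ t) ⊆ A ∪ B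

theorem CanMove.mono {c d : ℝ} {A B A' B' : Set Plane} (h : CanMove c d A B) (hA : A ⊆ A')
    (hB : B ⊆ B') : CanMove c d A' B' := by
  obtain ⟨z₁, z₂, u₁, u₂, h1, h2, h3, h4, h5, h6, h7, h8⟩ := h
  exact ⟨z₁, z₂, u₁, u₂, h1, h2, h3, h4, h5, h6.trans hA, h7.trans hB,
    fun t => (h8 t).trans (union_subset_union hA hB)⟩

theorem tiltedRect_reflect_subset {c d z₁ z₂ u₁ u₂ b : ℝ} {A A' : Set Plane}
    (hA : ∀ p ∈ A, !₂[p 0, b - p 1] ∈ A') (h : tiltedRect c d z₁ z₂ u₁ u₂ ⊆ A) :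
    tiltedRect c d z₁ (b - z₂) u₁ (-u₂) ⊆ A' := by
  rintro p ⟨s, r, hs, hr, h0, h1⟩
  have hq : !₂[p 0, b - p 1] ∈ A :=
    h ⟨s, -r, hs, by rwa [abs_neg], by simp [h0], by simp [h1]; ring⟩
  have := hA _ hq
  convert this using 1
  ext i
  fin_cases i <;> simp

/-- The reflection `y ↦ b - y` carries motions to motions. -/
theorem CanMove.reflect {c d b : ℝ} {A B A' B' : Set Plane} (h : CanMove c d A B)
    (hA : ∀ p ∈ A, !₂[p 0, b - p 1] ∈ A') (hB : ∀ p ∈ B, !₂[p 0, b - p 1] ∈ B') :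
    CanMove c d A' B' := by
  obtain ⟨z₁, z₂, u₁, u₂, h1, h2, h3, h4, h5, h6, h7, h8⟩ := h
  refine ⟨z₁, fun t => b - z₂ t, u₁, fun t => -u₂ t, h1, by fun_prop, h3, by fun_prop,
    fun t => by rw [neg_sq]; exact h5 t, tiltedRect_reflect_subset hA h6,
    tiltedRect_reflect_subset hB h7, fun t => tiltedRect_reflect_subset ?_ (h8 t)⟩
  rintro p (hp | hp)
  exacts [Or.inl (hA p hp), Or.inr (hB p hp)]

theorem IsOpenRectangle.symm {c d : ℝ} {R : Set Plane} (h : IsOpenRectangle c d R) :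
    IsOpenRectangle d c R := by
  obtain ⟨hc, hd, g, rfl⟩ := h
  let e : Plane ≃ₗᵢ[ℝ] Plane := LinearIsometryEquiv.piLpCongrLeft 2 ℝ ℝ (Equiv.swap 0 1)
  have he0 : ∀ p, e p 0 = p 1 := fun p => by
    simp [e, LinearIsometryEquiv.piLpCongrLeft_apply, Equiv.piCongrLeft'_apply]
  have he1 : ∀ p, e p 1 = p 0 := fun p => by
    simp [e, LinearIsometryEquiv.piLpCongrLeft_apply, Equiv.piCongrLeft'_apply]
  have hee : ∀ p, e (e p) = p := fun p => by
    ext i; fin_cases i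
    · exact (he0 _).trans (he1 _)
    · exact (he1 _).trans (he0 _)
  refine ⟨hd, hc, e.toAffineIsometryEquiv.trans g, ?_⟩
  ext q
  constructor
  · rintro ⟨p, ⟨h1, h2⟩, rfl⟩
    refine ⟨e p, ⟨by rwa [he0], by rwa [he1]⟩, ?_⟩
    simp [hee]
  · rintro ⟨p, ⟨h1, h2⟩, rfl⟩
    refine ⟨e p, ⟨by rwa [he0], by rwa [he1]⟩, ?_⟩
    simp

theorem orthonormal_coords {u₁ u₂ v₁ v₂ : ℝ} (hu : u₁ ^ 2 + u₂ ^ 2 = 1)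
    (hv : v₁ ^ 2 + v₂ ^ 2 = 1) (huv : u₁ * v₁ + u₂ * v₂ = 0) :
    (v₁ = -u₂ ∧ v₂ = u₁) ∨ (v₁ = u₂ ∧ v₂ = -u₁) := by
  have e : (u₁ * v₂ - u₂ * v₁) ^ 2 = 1 := by linear_combination v₁ ^ 2 * hu + v₂ ^ 2 * hu + hv - (u₁ * v₁ + u₂ * v₂) * huv
  rcases sq_eq_one_iff.1 e with h | h
  · left; constructor
    · linear_combination -u₂ * h + u₁ * huv - v₁ * hu
    · linear_combination u₁ * h + u₂ * huv - v₂ * hu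
  · right; constructor
    · linear_combination -u₂ * h + u₁ * huv - v₁ * hu
    · linear_combination u₁ * h + u₂ * huv - v₂ * hu

/-- Orientation reversing isometries are included, hence the two possible signs of the second axis.
-/
theorem planeIsometry_coords (ψ : Plane ≃ᵃⁱ[ℝ] Plane) (x y : ℝ) :
    let u := ψ !₂[x + 1, y] - ψ !₂[x, y]
    let v := ψ !₂[x, y + 1] - ψ !₂[x, y]
    (u 0 ^ 2 + u 1 ^ 2 = 1) ∧
    ((v 0 = -u 1 ∧ v 1 = u 0) ∨ (v 0 = u 1 ∧ v 1 = -u 0)) ∧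
    ∀ s r : ℝ, ψ !₂[x + s, y + r] = ψ !₂[x, y] + s • u + r • v := by
  intro u v
  have key : ∀ s r : ℝ, ψ !₂[x + s, y + r] = ψ !₂[x, y] + ψ.linearIsometryEquiv !₂[s, r] := by
    intro s r
    have := ψ.map_vadd !₂[x, y] !₂[s, r]
    rw [vadd_eq_add, vadd_eq_add, add_comm] at this
    rw [add_comm (ψ _), ← this]
    congr 1
    ext i; fin_cases i <;> simp
  have hu : u = ψ.linearIsometryEquiv !₂[1, 0] := by
    have := key 1 0
    rw [add_zero] at this
    simp only [u, this, add_sub_cancel_left]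
  have hv : v = ψ.linearIsometryEquiv !₂[0, 1] := by
    have := key 0 1
    rw [add_zero] at this
    simp only [v, this, add_sub_cancel_left]
  have iu : inner ℝ u u = 1 := by
    rw [hu, LinearIsometryEquiv.inner_map_map]; norm_num [PiLp.inner_apply, Fin.sum_univ_two, EuclideanSpace.norm_eq]
  have iv : inner ℝ v v = 1 := by
    rw [hv, LinearIsometryEquiv.inner_map_map]; norm_num [PiLp.inner_apply, Fin.sum_univ_two, EuclideanSpace.norm_eq]
  have iuv : inner ℝ u v = 0 := by
    rw [hu, hv, LinearIsometryEquiv.inner_map_map]; simp [PiLp.inner_apply, Fin.sum_univ_two]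
  simp only [PiLp.inner_apply, Fin.sum_univ_two, RCLike.inner_apply, conj_trivial] at iu iv iuv
  refine ⟨by linarith, orthonormal_coords (by linarith) (by linarith) (by linarith), ?_⟩
  intro s r
  rw [key, hu, hv, ← map_smul, ← map_smul, add_assoc, ← map_add]
  congr 2
  ext i; fin_cases i <;> simp

theorem plane_eta (p : Plane) : p = !₂[p 0, p 1] := by
  ext i; fin_cases i <;> simp

/-- The sign of the second axis is lost because the box is symmetric about its midlines, so the
centre and one axis determine the image. -/
theorem image_box_eq_tiltedRect (ψ : Plane ≃ᵃⁱ[ℝ] Plane) (c d : ℝ) :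
    ψ '' {p : Plane | (0 < p 0 ∧ p 0 < c) ∧ (0 < p 1 ∧ p 1 < d)} =
      tiltedRect c d (ψ !₂[c / 2, d / 2] 0) (ψ !₂[c / 2, d / 2] 1)
        ((ψ !₂[c / 2 + 1, d / 2] - ψ !₂[c / 2, d / 2]) 0)
        ((ψ !₂[c / 2 + 1, d / 2] - ψ !₂[c / 2, d / 2]) 1) := by
  obtain ⟨-, hv, key⟩ := planeIsometry_coords ψ (c / 2) (d / 2)
  set u := ψ !₂[c / 2 + 1, d / 2] - ψ !₂[c / 2, d / 2]
  set v := ψ !₂[c / 2, d / 2 + 1] - ψ !₂[c / 2, d / 2]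
  ext q
  constructor
  · rintro ⟨p, ⟨⟨h1, h2⟩, h3, h4⟩, rfl⟩
    have e : ψ p = ψ !₂[c / 2, d / 2] + (p 0 - c / 2) • u + (p 1 - d / 2) • v := by
      rw [← key]; congr 1; rw [plane_eta p]; simp
    have hs : |p 0 - c / 2| < c / 2 := by rw [abs_lt]; constructor <;> linarith
    have hr : |p 1 - d / 2| < d / 2 := by rw [abs_lt]; constructor <;> linarith
    rcases hv with ⟨h0, h1⟩ | ⟨h0, h1⟩
    · refine ⟨p 0 - c / 2, p 1 - d / 2, hs, hr, ?_, ?_⟩ <;> rw [e] <;>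
        simp [h0, h1]; ring
    · refine ⟨p 0 - c / 2, -(p 1 - d / 2), hs, by rwa [abs_neg], ?_, ?_⟩ <;> rw [e] <;>
        simp [h0, h1] <;> ring
  · rintro ⟨s, r, hs, hr, e0, e1⟩
    rw [abs_lt] at hs hr
    rcases hv with ⟨h0, h1⟩ | ⟨h0, h1⟩
    · refine ⟨!₂[c / 2 + s, d / 2 + r], ?_, ?_⟩
      · simp; refine ⟨⟨?_, ?_⟩, ?_, ?_⟩ <;> linarith
      · rw [key, plane_eta q, e0, e1]
        ext i; fin_cases i <;> simp [h0, h1] ; ring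
    · refine ⟨!₂[c / 2 + s, d / 2 + -r], ?_, ?_⟩
      · simp; refine ⟨⟨?_, ?_⟩, ?_, ?_⟩ <;> linarith
      · rw [key, plane_eta q, e0, e1]
        ext i; fin_cases i <;> simp [h0, h1] ; ring

/-- The orientation preserving isometry `p ↦ (z₁, z₂) + p₀ (u₁, u₂) + p₁ (-u₂, u₁)`. -/
def frameLinear (u₁ u₂ : ℝ) : Plane →ₗ[ℝ] Plane where
  toFun p := !₂[p 0 * u₁ - p 1 * u₂, p 0 * u₂ + p 1 * u₁]
  map_add' p q := by ext i; fin_cases i <;> simp <;> ring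
  map_smul' k p := by ext i; fin_cases i <;> simp <;> ring

theorem exists_frameIsometry (z₁ z₂ u₁ u₂ : ℝ) (hu : u₁ ^ 2 + u₂ ^ 2 = 1) :
    ∃ ψ : Plane ≃ᵃⁱ[ℝ] Plane,
      ∀ p, ψ p = !₂[z₁ + p 0 * u₁ - p 1 * u₂, z₂ + p 0 * u₂ + p 1 * u₁] := by
  have hn : ∀ p, ‖frameLinear u₁ u₂ p‖ = ‖p‖ := by
    intro p
    rw [EuclideanSpace.norm_eq, EuclideanSpace.norm_eq]
    congr 1
    simp [Fin.sum_univ_two, frameLinear]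
    linear_combination (p 0 ^ 2 + p 1 ^ 2) * hu
  let L : Plane →ₗᵢ[ℝ] Plane := ⟨frameLinear u₁ u₂, hn⟩
  let E := L.toLinearIsometryEquiv rfl
  refine ⟨E.toAffineIsometryEquiv.trans (AffineIsometryEquiv.constVAdd ℝ Plane !₂[z₁, z₂]), ?_⟩
  intro p
  have : E p = !₂[p 0 * u₁ - p 1 * u₂, p 0 * u₂ + p 1 * u₁] := rfl
  simp [this]
  ext i; fin_cases i <;> simp <;> ring

/-- Centre and axis depend continuously on the motion because they are differences and values of the
images of two fixed points. Conversely, undoing `g`, recentring the box at the origin and applying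
the frame isometry recovers a motion path. -/
theorem mem_movableRectangles_iff {a b c d : ℝ} {R : Set Plane} (hR : IsOpenRectangle c d R)
    (i : Fin 2) (j : Fin 4) :
    R ∈ movableRectangles a b i j ↔ CanMove c d (armA a b i) (armB a b j) := by
  have hR' := hR
  obtain ⟨hc, hd, g, rfl⟩ := hR
  constructor
  · rintro ⟨-, Φ, hΦ, h0, h1, ht⟩
    have e : ∀ t, Φ t '' (g '' {p : Plane | (0 < p 0 ∧ p 0 < c) ∧ (0 < p 1 ∧ p 1 < d)}) =
        (g.trans (Φ t)) '' {p : Plane | (0 < p 0 ∧ p 0 < c) ∧ (0 < p 1 ∧ p 1 < d)} := by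
      intro t; rw [image_image]; rfl
    have hcont : ∀ p, Continuous fun t => (g.trans (Φ t)) p := fun p => hΦ (g p)
    have hcont' : ∀ p i, Continuous fun t => (g.trans (Φ t)) p i := fun p i => by
      have := hcont p
      fun_prop
    simp only [e] at h0 h1 ht
    simp only [image_box_eq_tiltedRect (g.trans (Φ _))] at h0 h1 ht
    refine ⟨_, _, _, _, ?_, ?_, ?_, ?_, fun t => ?_, h0, h1, ht⟩
    · exact hcont' _ _
    · exact hcont' _ _
    · exact (hcont' _ _).sub (hcont' _ _)
    · exact (hcont' _ _).sub (hcont' _ _)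
    · exact (planeIsometry_coords (g.trans (Φ t)) (c / 2) (d / 2)).1
  · rintro ⟨z₁, z₂, u₁, u₂, h1, h2, h3, h4, h5, h6, h7, h8⟩
    refine ⟨⟨c, d, hR'⟩, ?_⟩
    choose ψ hψ using fun t => exists_frameIsometry (z₁ t) (z₂ t) (u₁ t) (u₂ t) (h5 t)
    let τ : Plane ≃ᵃⁱ[ℝ] Plane := AffineIsometryEquiv.constVAdd ℝ Plane !₂[-(c / 2), -(d / 2)]
    have e : ∀ t, (g.symm.trans (τ.trans (ψ t))) ''
        (g '' {p : Plane | (0 < p 0 ∧ p 0 < c) ∧ (0 < p 1 ∧ p 1 < d)}) =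
        tiltedRect c d (z₁ t) (z₂ t) (u₁ t) (u₂ t) := by
      intro t
      have e1 : (g.symm.trans (τ.trans (ψ t))) ''
        (g '' {p : Plane | (0 < p 0 ∧ p 0 < c) ∧ (0 < p 1 ∧ p 1 < d)}) =
        (τ.trans (ψ t)) '' {p : Plane | (0 < p 0 ∧ p 0 < c) ∧ (0 < p 1 ∧ p 1 < d)} := by
        rw [image_image]; simp
      rw [e1, image_box_eq_tiltedRect]
      congr 1 <;> simp [hψ, τ]
    refine ⟨fun t => g.symm.trans (τ.trans (ψ t)), fun p => ?_, ?_, ?_, fun t => ?_⟩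
    · simp only [AffineIsometryEquiv.coe_trans, Function.comp_apply, hψ]
      refine (PiLp.continuous_toLp 2 _).comp (continuous_pi fun i => ?_)
      fin_cases i <;> simp <;> fun_prop
    · simp only [e]; exact h6
    · simp only [e]; exact h7
    · simp only [e]; exact h8 t

/-! ### Normalised tilt and passage to the boundary -/

theorem tiltedRect_neg (c d z₁ z₂ u₁ u₂ : ℝ) :
    tiltedRect c d z₁ z₂ (-u₁) (-u₂) = tiltedRect c d z₁ z₂ u₁ u₂ := by
  have key : ∀ v₁ v₂, tiltedRect c d z₁ z₂ v₁ v₂ ⊆ tiltedRect c d z₁ z₂ (-v₁) (-v₂) := by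
    rintro v₁ v₂ p ⟨s, r, hs, hr, h0, h1⟩
    exact ⟨-s, -r, by rwa [abs_neg], by rwa [abs_neg], by rw [h0]; ring, by rw [h1]; ring⟩
  refine Subset.antisymm ?_ (key _ _)
  have := key (-u₁) (-u₂)
  rwa [neg_neg, neg_neg] at this

theorem tiltedRect_rotate (c d z₁ z₂ u₁ u₂ : ℝ) :
    tiltedRect c d z₁ z₂ u₁ u₂ = tiltedRect d c z₁ z₂ u₂ (-u₁) := by
  ext p
  constructor
  · rintro ⟨s, r, hs, hr, h0, h1⟩
    exact ⟨-r, s, by rwa [abs_neg], hs, by rw [h0]; ring, by rw [h1]; ring⟩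
  · rintro ⟨s, r, hs, hr, h0, h1⟩
    exact ⟨r, -s, hr, by rwa [abs_neg], by rw [h0]; ring, by rw [h1]; ring⟩

theorem tiltedRect_eq_of_mul_nonpos {c d z₁ z₂ u₁ u₂ : ℝ} (h : u₁ * u₂ ≤ 0) :
    tiltedRect c d z₁ z₂ u₁ u₂ = tiltedRect c d z₁ z₂ |u₁| (-|u₂|) := by
  rcases mul_nonpos_iff.1 h with ⟨h1, h2⟩ | ⟨h1, h2⟩
  · rw [abs_of_nonneg h1, abs_of_nonpos h2, neg_neg]
  · rw [abs_of_nonpos h1, abs_of_nonneg h2, tiltedRect_neg]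

/-- Up to exchanging the roles of the sides, the first axis may be taken to point to the right and
downwards, so later lemmas treat only the direction `(C, -S)`. -/
theorem tiltedRect_eq_or (c d z₁ z₂ u₁ u₂ : ℝ) :
    tiltedRect c d z₁ z₂ u₁ u₂ = tiltedRect c d z₁ z₂ |u₁| (-|u₂|) ∨
      tiltedRect c d z₁ z₂ u₁ u₂ = tiltedRect d c z₁ z₂ |u₂| (-|u₁|) := by
  rcases le_total (u₁ * u₂) 0 with h | h
  · exact Or.inl (tiltedRect_eq_of_mul_nonpos h)
  · right
    rw [tiltedRect_rotate, tiltedRect_eq_of_mul_nonpos (by linarith), abs_neg]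

theorem forall_mem_tiltedRect {l w z₁ z₂ C S : ℝ} {P : ℝ → ℝ → Prop}
    (h : ∀ p ∈ tiltedRect l w z₁ z₂ C (-S), P (p 0) (p 1)) {s r : ℝ} (hs : |s| < l / 2)
    (hr : |r| < w / 2) : P (z₁ + s * C + r * S) (z₂ - s * S + r * C) :=
  h !₂[z₁ + s * C + r * S, z₂ - s * S + r * C]
    ⟨s, r, hs, hr, by simp, by simp; ring⟩

/-- Shrinking towards the centre by a factor slightly below `1` moves a point of the closed
rectangle into the open one. -/
theorem exists_interior_near {l w σ ρ : ℝ} (hl : 0 < l) (hw : 0 < w) (hσ : |σ| ≤ l / 2)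
    (hρ : |ρ| ≤ w / 2) {U : Set (ℝ × ℝ)} (hU : IsOpen U) (h : (σ, ρ) ∈ U) :
    ∃ s r : ℝ, |s| < l / 2 ∧ |r| < w / 2 ∧ (s, r) ∈ U := by
  have hc : Continuous fun k : ℝ => (k * σ, k * ρ) := by fun_prop
  have h1 : ∀ᶠ k in nhdsWithin (1 : ℝ) (Iio 1), (k * σ, k * ρ) ∈ U :=
    nhdsWithin_le_nhds (hc.continuousAt.eventually (hU.mem_nhds (by simpa using h)))
  have h2 : ∀ᶠ k in nhdsWithin (1 : ℝ) (Iio 1), k ∈ Ioo (0 : ℝ) 1 :=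
    Ioo_mem_nhdsLT one_pos
  obtain ⟨k, hk, hk0, hk1⟩ := (h1.and h2).exists
  refine ⟨k * σ, k * ρ, ?_, ?_, hk⟩
  · rw [abs_mul, abs_of_pos hk0]; nlinarith [abs_nonneg σ]
  · rw [abs_mul, abs_of_pos hk0]; nlinarith [abs_nonneg ρ]

theorem affine_nonneg_of_local {l w k p q k' p' q' σ ρ : ℝ} (hl : 0 < l) (hw : 0 < w)
    (h : ∀ s r : ℝ, |s| < l / 2 → |r| < w / 2 → 0 < k' + s * p' + r * q' →
      0 ≤ k + s * p + r * q)
    (hσ : |σ| ≤ l / 2) (hρ : |ρ| ≤ w / 2) (hpos : 0 < k' + σ * p' + ρ * q') :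
    0 ≤ k + σ * p + ρ * q := by
  by_contra! hneg
  obtain ⟨s, r, hs, hr, h1, h2⟩ := exists_interior_near hl hw hσ hρ
    (U := {x | 0 < k' + x.1 * p' + x.2 * q'} ∩ {x | k + x.1 * p + x.2 * q < 0})
    ((isOpen_lt (by fun_prop) (by fun_prop)).inter (isOpen_lt (by fun_prop) (by fun_prop)))
    ⟨hpos, hneg⟩
  exact absurd (h s r hs hr h1) (not_le.2 h2)

theorem affine_nonneg_of_interior {l w k p q σ ρ : ℝ} (hl : 0 < l) (hw : 0 < w)
    (h : ∀ s r : ℝ, |s| < l / 2 → |r| < w / 2 → 0 ≤ k + s * p + r * q)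
    (hσ : |σ| ≤ l / 2) (hρ : |ρ| ≤ w / 2) : 0 ≤ k + σ * p + ρ * q :=
  affine_nonneg_of_local (k' := 1) (p' := 0) (q' := 0) hl hw (fun s r hs hr _ => h s r hs hr)
    hσ hρ (by norm_num)

/-! ### Chords, crossings and the corner inequality -/

/-- If the door has height `b`, a rectangle all of whose central vertical chords are longer than
`b` cannot have its centre near the door. -/
theorem chord_bound {a b l w C S z₁ z₂ : ℝ} (hC : 0 ≤ C) (hS : 0 ≤ S)
    (hCS : C ^ 2 + S ^ 2 = 1) (hb : 0 < b) (hl : b * S < l) (hw : b * C < w)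
    (door : ∀ s r : ℝ, |s| < l / 2 → |r| < w / 2 → z₁ + s * C + r * S = a →
      0 < z₂ - s * S + r * C ∧ z₂ - s * S + r * C < b) :
    (l * C + w * S) / 2 - b * S * C ≤ |a - z₁| := by
  by_contra! h
  -- A vertical segment of length `b` has extent `b S` and `b C` along the two axes. So `α` and `β`
  -- are the half sides of the rectangle formed by the midpoints of such chords, and `N` is its
  -- horizontal half width.
  set α := (l - b * S) / 2 with hα
  set β := (w - b * C) / 2 with hβ
  have hα0 : 0 < α := by rw [hα]; linarith
  have hβ0 : 0 < β := by rw [hβ]; linarith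
  set N := α * C + β * S with hN
  have hN' : |a - z₁| < N := by
    refine h.trans_le (le_of_eq ?_); rw [hN, hα, hβ]; ring
  have hN0 : 0 < N := (abs_nonneg _).trans_lt hN'
  set e := (a - z₁) / N with he
  have he1 : |e| < 1 := by rw [he, abs_div, abs_of_pos hN0, div_lt_one hN0]; exact hN'
  have heN : e * N = a - z₁ := by rw [he]; field_simp
  rw [abs_lt] at he1
  have i1 : α * e < α := by nlinarith
  have i2 : -α < α * e := by nlinarith
  have i3 : β * e < β := by nlinarith
  have i4 : -β < β * e := by nlinarith
  have hbS : 0 ≤ b * S := by positivity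
  have hbC : 0 ≤ b * C := by positivity
  have hx : z₁ + (α * e) * C + (β * e) * S = a := by
    have : α * e * C + β * e * S = e * N := by rw [hN]; ring
    linarith
  -- The two ends of a chord of length `b` on `x = a`: both would have to lie strictly between
  -- heights `0` and `b`.
  have d1 := door (α * e - b * S / 2) (β * e + b * C / 2)
    (by rw [abs_lt]; constructor <;> linarith) (by rw [abs_lt]; constructor <;> linarith)
    (by linarith)
  have d2 := door (α * e + b * S / 2) (β * e - b * C / 2)
    (by rw [abs_lt]; constructor <;> linarith) (by rw [abs_lt]; constructor <;> linarith)
    (by linarith)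
  have : b * (C ^ 2 + S ^ 2) = b := by rw [hCS, mul_one]
  nlinarith [d1.2, d2.1]

/-- A rectangle whose upper right side crosses the line of the door, and whose lower left side has
its end points in the closed quadrant, leaves the inner corner `(a, b)` on the far side. -/
theorem width_le_of_crossing {a b l w C S z₁ z₂ : ℝ} (hC : 0 < C) (hS : 0 < S)
    (hCS : C ^ 2 + S ^ 2 = 1) (hw : 0 < w)
    (door : ∀ s r : ℝ, |s| < l / 2 → |r| < w / 2 → z₁ + s * C + r * S = a →
      z₂ - s * S + r * C < b)
    (hL : (l * C + w * S) / 2 ≤ z₁) (hB : (l * S + w * C) / 2 ≤ z₂)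
    (hT : z₁ - l / 2 * C + w / 2 * S ≤ a) (hR : a < z₁ + (l * C + w * S) / 2) :
    w ≤ a * S + b * C - l * S * C := by
  by_contra! h
  -- Measured along the normal `(S, C)`, the upper right side is at height at least `l S C + w`,
  -- hence beyond `(a, b)`. A point just inside that side on `x = a` is then above the door.
  have hk : l * S * C + w / 2 ≤ z₁ * S + z₂ * C := by nlinarith
  have m1 : a * S + b * C - z₁ * S - z₂ * C < w / 2 := by linarith
  have m2 : (a - z₁ - l / 2 * C) / S < w / 2 := by rw [div_lt_iff₀ hS]; linarith
  obtain ⟨r, hr, hrw⟩ := exists_between (max_lt m1 (max_lt m2 (by linarith : -(w / 2) < w / 2)))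
  rw [max_lt_iff, max_lt_iff, div_lt_iff₀ hS] at hr
  obtain ⟨r1, r2, r3⟩ := hr
  have hs : |(a - z₁ - r * S) / C| < l / 2 := by
    rw [abs_lt, lt_div_iff₀ hC, div_lt_iff₀ hC]
    constructor <;> nlinarith
  have hx : z₁ + (a - z₁ - r * S) / C * C + r * S = a := by field_simp; ring
  have := door _ r hs (abs_lt.2 ⟨r3, hrw⟩) hx
  set s := (a - z₁ - r * S) / C
  have e : a * S + (z₂ - s * S + r * C) * C = z₁ * S + z₂ * C + r * (C ^ 2 + S ^ 2) := by
    rw [← hx]; ring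
  rw [hCS] at e
  nlinarith

/-- Multiplying the corner inequality by `d` and replacing `c d` by `a b` leaves exactly the product
in the hypothesis. -/
theorem corner_key {a b c d C S : ℝ} (hC : 0 ≤ C) (hS : 0 ≤ S) (hd : 0 < d)
    (hcd : c * d ≤ a * b) (h : 0 ≤ (a * S - d) * (d - b * C)) :
    d ≤ a * S + b * C - c * S * C := by
  have hSC : 0 ≤ S * C := by positivity
  have : 0 ≤ d * (a * S + b * C - c * S * C - d) := by nlinarith
  nlinarith [nonneg_of_mul_nonneg_right this hd]

/-- For `d ≤ h`, a tilt with `b C < d` has `a S ≥ d`, so `corner_key` applies; at the other tilts `S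
(a - c C) ≥ 0` is enough. -/
theorem corner_of_low {a b c d C S : ℝ} (ha : 0 < a) (hb : 0 < b) (hC : 0 ≤ C) (hS : 0 ≤ S)
    (hCS : C ^ 2 + S ^ 2 = 1) (hd : 0 < d) (hcd : c * d ≤ a * b)
    (hh : d ^ 2 * (a ^ 2 + b ^ 2) ≤ a ^ 2 * b ^ 2) (hcC : c * C ≤ a) :
    d ≤ a * S + b * C - c * S * C := by
  rcases le_or_gt d (b * C) with h | h
  · nlinarith
  · refine corner_key hC hS hd hcd (mul_nonneg ?_ (by linarith))
    have h1 : b ^ 2 * C ^ 2 ≤ d ^ 2 := by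
      rw [← mul_pow]; exact pow_le_pow_left₀ (by positivity) h.le 2
    have h2 : (d * b) ^ 2 ≤ (a * S * b) ^ 2 := by
      have : S ^ 2 = 1 - C ^ 2 := by linarith
      calc (d * b) ^ 2 ≤ a ^ 2 * b ^ 2 - a ^ 2 * d ^ 2 := by linarith
        _ ≤ a ^ 2 * b ^ 2 - a ^ 2 * (b ^ 2 * C ^ 2) := by nlinarith [sq_nonneg a]
        _ = (a * S * b) ^ 2 := by rw [mul_pow, mul_pow, this]; ring
    have := le_of_mul_le_mul_right ((le_abs_self _).trans (abs_le_of_sq_le_sq h2 (by positivity))) hb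
    linarith

/-- For `d ≥ h`, a tilt with `d ≤ b C` has `a S ≤ d`: both factors in `corner_key` are nonpositive.
-/
theorem corner_of_high {a b c d C S : ℝ} (hb : 0 < b) (hC : 0 ≤ C) (hS : 0 ≤ S)
    (hCS : C ^ 2 + S ^ 2 = 1) (hd : 0 < d) (hcd : c * d ≤ a * b)
    (hh : a ^ 2 * b ^ 2 ≤ d ^ 2 * (a ^ 2 + b ^ 2)) (hbC : d ≤ b * C) :
    d ≤ a * S + b * C - c * S * C := by
  refine corner_key hC hS hd hcd (mul_nonneg_of_nonpos_of_nonpos ?_ (by linarith))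
  have h1 : d ^ 2 ≤ b ^ 2 * C ^ 2 := by
    rw [← mul_pow]; exact pow_le_pow_left₀ hd.le hbC 2
  have h2 : (a * S * b) ^ 2 ≤ (d * b) ^ 2 := by
    have : S ^ 2 = 1 - C ^ 2 := by linarith
    calc (a * S * b) ^ 2 = a ^ 2 * b ^ 2 - a ^ 2 * (b ^ 2 * C ^ 2) := by
          rw [mul_pow, mul_pow, this]; ring
      _ ≤ a ^ 2 * b ^ 2 - a ^ 2 * d ^ 2 := by nlinarith [sq_nonneg a]
      _ ≤ (d * b) ^ 2 := by linarith
  have := le_of_mul_le_mul_right ((le_abs_self _).trans (abs_le_of_sq_le_sq h2 (by positivity))) hb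
  linarith

theorem corner_of_extent_le {a b c d C S : ℝ} (hC : 0 ≤ C) (hS : 0 ≤ S)
    (hCS : C ^ 2 + S ^ 2 = 1) (hd : 0 < d) (hdb : d ≤ b) (h : c * C + d * S ≤ a) :
    d ≤ a * S + b * C - c * S * C := by
  have hC1 : C ≤ 1 := by nlinarith
  nlinarith [mul_nonneg hS (sub_nonneg.2 h), mul_nonneg hC (sub_nonneg.2 hdb),
    mul_nonneg (mul_nonneg hd.le hC) (sub_nonneg.2 hC1)]

/-- If a rectangle is too wide for the corner at some tilt, then so it is when turned by a right
angle and reflected. -/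
theorem corner_mirror {a b c d C S : ℝ} (hC : 0 ≤ C) (hS : 0 ≤ S) (hCS : C ^ 2 + S ^ 2 = 1)
    (hca : a ≤ c) (hcb : b ≤ c) (hda : d ≤ a) (hdb : d ≤ b)
    (h : a * S + b * C - c * S * C < d) : a * C + b * S - d * S * C < c := by
  have hC1 : C ≤ 1 := by nlinarith
  have hS1 : S ≤ 1 := by nlinarith
  have h1 : 0 ≤ (1 - C) * (1 + S) := mul_nonneg (by linarith) (by linarith)
  have h2 : 0 ≤ (1 - S) * (1 + C) := mul_nonneg (by linarith) (by linarith)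
  have h3 : 0 ≤ 1 - S * C := by nlinarith
  -- The two deficits differ by `(c - d)(1 - S C) - (a - b)(C - S)`, which is nonnegative because `c
  -- - d ≥ |a - b|`.
  rcases le_total a b with hab | hab
  · nlinarith [mul_nonneg (sub_nonneg.2 hab) h2, mul_nonneg (by linarith : 0 ≤ c - d - (b - a)) h3]
  · nlinarith [mul_nonneg (sub_nonneg.2 hab) h1, mul_nonneg (by linarith : 0 ≤ c - d - (a - b)) h3]

/-- The vector `(C, S)` lies on the arc from `(C₀, S₀)` to `(1, 0)`, so it is a combination of these
with nonnegative coefficients of sum at least `1`. The linear form `c C + d S` exceeds `a` at both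
ends. -/
theorem extent_gt_of_le {a c d C S C₀ S₀ : ℝ} (ha : 0 < a) (hS : 0 ≤ S) (hC₀ : 0 ≤ C₀)
    (hS₀ : 0 < S₀) (hCS : C ^ 2 + S ^ 2 = 1) (hCS₀ : C₀ ^ 2 + S₀ ^ 2 = 1) (hle : C₀ ≤ C)
    (hca : a < c) (h : a < c * C₀ + d * S₀) : a < c * C + d * S := by
  have hSS : S ≤ S₀ := by nlinarith
  set α := S / S₀ with hα
  have hα0 : 0 ≤ α := by positivity
  have hα1 : α ≤ 1 := by rw [hα, div_le_one hS₀]; exact hSS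
  have eS : S = α * S₀ := by rw [hα]; field_simp
  set β := C - α * C₀ with hβ
  have hβ0 : 0 ≤ β := by nlinarith
  have eC : C = α * C₀ + β := by rw [hβ]; ring
  have hC₀1 : C₀ ≤ 1 := by nlinarith
  have hsum : 1 ≤ α + β := by
    have : 1 ≤ (α + β) ^ 2 := by
      have e : (α * C₀ + β) ^ 2 + (α * S₀) ^ 2 = α ^ 2 + β ^ 2 + 2 * (α * β) * C₀ := by
        linear_combination α ^ 2 * hCS₀
      rw [← hCS, eC, eS, e]
      nlinarith [mul_nonneg (mul_nonneg hα0 hβ0) (sub_nonneg.2 hC₀1)]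
    nlinarith
  have e : c * C + d * S = α * (c * C₀ + d * S₀) + β * c := by rw [eC, eS]; ring
  rw [e]
  rcases hα0.eq_or_lt with h0 | h0
  · rw [← h0] at hsum ⊢; nlinarith
  · nlinarith [mul_lt_mul_of_pos_left h h0]

/-! ### Horizontal and vertical extent of a rectangle -/

theorem left_extent {c d z₁ z₂ u₁ u₂ k : ℝ} (hc : 0 < c) (hd : 0 < d)
    (h : ∀ p ∈ tiltedRect c d z₁ z₂ u₁ u₂, k ≤ p 0) :
    k + (c * |u₁| + d * |u₂|) / 2 ≤ z₁ := by
  rcases tiltedRect_eq_or c d z₁ z₂ u₁ u₂ with e | e <;> rw [e] at h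
  · have := affine_nonneg_of_interior (k := z₁ - k) (p := |u₁|) (q := |u₂|) (σ := -(c / 2))
      (ρ := -(d / 2)) hc hd
      (fun s r hs hr => by
        linarith [forall_mem_tiltedRect (P := fun x _ => k ≤ x) h hs hr])
      (by rw [abs_neg, abs_of_pos (by positivity)]) (by rw [abs_neg, abs_of_pos (by positivity)])
    linarith
  · have := affine_nonneg_of_interior (k := z₁ - k) (p := |u₂|) (q := |u₁|) (σ := -(d / 2))
      (ρ := -(c / 2)) hd hc
      (fun s r hs hr => by
        linarith [forall_mem_tiltedRect (P := fun x _ => k ≤ x) h hs hr])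
      (by rw [abs_neg, abs_of_pos (by positivity)]) (by rw [abs_neg, abs_of_pos (by positivity)])
    linarith

theorem tiltedRect_opposite {c d z₁ z₂ u₁ u₂ : ℝ} {p : Plane}
    (hp : p ∈ tiltedRect c d (-z₁) (-z₂) u₁ u₂) : !₂[-p 0, -p 1] ∈ tiltedRect c d z₁ z₂ u₁ u₂ := by
  obtain ⟨s, r, hs, hr, h0, h1⟩ := hp
  exact ⟨-s, -r, by rwa [abs_neg], by rwa [abs_neg], by simp [h0]; ring, by simp [h1]; ring⟩

theorem tiltedRect_quarter {c d z₁ z₂ u₁ u₂ : ℝ} {p : Plane}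
    (hp : p ∈ tiltedRect c d z₂ (-z₁) u₂ (-u₁)) : !₂[-p 1, p 0] ∈ tiltedRect c d z₁ z₂ u₁ u₂ := by
  obtain ⟨s, r, hs, hr, h0, h1⟩ := hp
  exact ⟨s, r, hs, hr, by simp [h1]; ring, by simp [h0]⟩

theorem right_extent {c d z₁ z₂ u₁ u₂ k : ℝ} (hc : 0 < c) (hd : 0 < d)
    (h : ∀ p ∈ tiltedRect c d z₁ z₂ u₁ u₂, p 0 ≤ k) :
    z₁ + (c * |u₁| + d * |u₂|) / 2 ≤ k := by
  have := left_extent (k := -k) hc hd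
    (fun p hp => by have := h _ (tiltedRect_opposite hp); simp at this; linarith)
  linarith

theorem bottom_extent {c d z₁ z₂ u₁ u₂ k : ℝ} (hc : 0 < c) (hd : 0 < d)
    (h : ∀ p ∈ tiltedRect c d z₁ z₂ u₁ u₂, k ≤ p 1) :
    k + (c * |u₂| + d * |u₁|) / 2 ≤ z₂ := by
  have := left_extent (k := k) hc hd
    (fun p hp => by simpa using h _ (tiltedRect_quarter hp))
  rwa [abs_neg] at this

theorem top_extent {c d z₁ z₂ u₁ u₂ k : ℝ} (hc : 0 < c) (hd : 0 < d)
    (h : ∀ p ∈ tiltedRect c d z₁ z₂ u₁ u₂, p 1 ≤ k) :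
    z₂ + (c * |u₂| + d * |u₁|) / 2 ≤ k := by
  have := bottom_extent (k := -k) hc hd
    (fun p hp => by have := h _ (tiltedRect_opposite hp); simp at this; linarith)
  linarith

theorem exists_mem_between {c d z₁ z₂ u₁ u₂ a b : ℝ} {p q : Plane}
    (hp : p ∈ tiltedRect c d z₁ z₂ u₁ u₂) (hq : q ∈ tiltedRect c d z₁ z₂ u₁ u₂)
    (hpa : p 0 < a) (hqa : a < q 0) (hpb : b < p 1) (hqb : b < q 1) :
    ∃ m ∈ tiltedRect c d z₁ z₂ u₁ u₂, m 0 = a ∧ b < m 1 := by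
  obtain ⟨s, r, hs, hr, h0, h1⟩ := hp
  obtain ⟨s', r', hs', hr', h0', h1'⟩ := hq
  obtain ⟨k, ⟨hk0, hk1⟩, hk⟩ : ∃ k ∈ Ioo (0 : ℝ) 1, p 0 + k * (q 0 - p 0) = a := by
    refine ⟨(a - p 0) / (q 0 - p 0), ⟨?_, ?_⟩, ?_⟩
    · apply div_pos <;> linarith
    · rw [div_lt_one] <;> linarith
    · rw [div_mul_cancel₀ _ (by linarith : q 0 - p 0 ≠ 0)]; ring
  rw [abs_lt] at hs hr hs' hr'
  refine ⟨!₂[p 0 + k * (q 0 - p 0), p 1 + k * (q 1 - p 1)],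
    ⟨s + k * (s' - s), r + k * (r' - r), ?_, ?_, ?_, ?_⟩, by simpa using hk, ?_⟩
  · rw [abs_lt]; constructor <;> nlinarith
  · rw [abs_lt]; constructor <;> nlinarith
  · simp [h0, h0']; ring
  · simp [h1, h1']; ring
  · simp; nlinarith

/-! ### The area bound -/

/-- The top and bottom vertices are at horizontal distance `|l C - w S| / 2` from the centre, and
between them the vertical chords have maximal length. Taking `k < 1` keeps the line of the door
strictly inside this range, so `chord_bound` forces `w ≤ b C` or `l ≤ b S`; the left extent supplies
the other factor of the area. -/
theorem area_bound_of_door {a b l w C S z₁ z₂ k : ℝ} (hb : 0 < b) (hl : 0 < l) (hw : 0 < w)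
    (hC : 0 ≤ C) (hS : 0 ≤ S) (hCS : C ^ 2 + S ^ 2 = 1) (hk0 : 0 ≤ k) (hk1 : k < 1)
    (hz : z₁ + k * (|l * C - w * S| / 2) = a) (hL : (l * C + w * S) / 2 ≤ z₁)
    (door : ∀ p ∈ tiltedRect l w z₁ z₂ C (-S), p 0 = a → 0 < p 1 ∧ p 1 < b) :
    (w ≤ b ∨ l ≤ b) ∧ l * w * (1 + k) ≤ 2 * (a * b) := by
  have hC1 : C ≤ 1 := by nlinarith
  have hS1 : S ≤ 1 := by nlinarith
  rcases le_or_gt w (b * C) with h | h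
  · refine ⟨Or.inl (by nlinarith), ?_⟩
    have h1 : l * C * (1 + k) ≤ 2 * a := by
      nlinarith [mul_le_mul_of_nonneg_left (le_abs_self (l * C - w * S)) hk0,
        mul_nonneg (sub_nonneg.2 hk1.le) (mul_nonneg hw.le hS)]
    have h2 : l * w * (1 + k) ≤ l * (b * C) * (1 + k) := by gcongr
    nlinarith
  rcases le_or_gt l (b * S) with h' | h'
  · refine ⟨Or.inr (by nlinarith), ?_⟩
    have h1 : w * S * (1 + k) ≤ 2 * a := by
      nlinarith [mul_le_mul_of_nonneg_left (neg_abs_le (l * C - w * S)) hk0,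
        mul_nonneg (sub_nonneg.2 hk1.le) (mul_nonneg hl.le hC)]
    have h2 : l * w * (1 + k) ≤ b * S * w * (1 + k) := by gcongr
    nlinarith
  exfalso
  have hch := chord_bound hC hS hCS hb h' h
    (fun s r hs hr => forall_mem_tiltedRect (P := fun x y => x = a → 0 < y ∧ y < b) door hs hr)
  have e : |a - z₁| = k * (|l * C - w * S| / 2) := by
    rw [← hz, add_sub_cancel_left, abs_of_nonneg (by positivity)]
  rw [e] at hch
  have p1 : 0 ≤ C * (l - b * S) := mul_nonneg hC (by linarith)
  have p2 : 0 ≤ S * (w - b * C) := mul_nonneg hS (by linarith)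
  have p3 : 0 < C * (l - b * S) + S * (w - b * C) := by
    rcases hC.eq_or_lt with h0 | h0
    · have : 0 < S := by rcases hS.eq_or_lt with h1 | h1; · rw [← h0, ← h1] at hCS; norm_num at hCS
                         · exact h1
      have := mul_pos this (sub_pos.2 h)
      linarith
    · have := mul_pos h0 (sub_pos.2 h')
      linarith
  rcases abs_cases (l * C - w * S) with ⟨e1, -⟩ | ⟨e1, -⟩ <;> rw [e1] at hch <;>
    nlinarith [mul_pos (sub_pos.2 hk1) p3, mul_nonneg hk0 p1, mul_nonneg hk0 p2]

theorem area_le_of_canMove {a b c d : ℝ} (ha : 0 < a) (hb : 0 < b) (hc : 0 < c) (hd : 0 < d)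
    (h : CanMove c d (armA0 a b) (armB0 a b)) : (d ≤ b ∨ c ≤ b) ∧ c * d ≤ a * b := by
  obtain ⟨z₁, z₂, u₁, u₂, h1, h2, h3, h4, h5, h6, h7, h8⟩ := h
  have main : ∀ k : ℝ, 0 ≤ k → k < 1 → (d ≤ b ∨ c ≤ b) ∧ c * d * (1 + k) ≤ 2 * (a * b) := by
    intro k hk0 hk1
    have hw0 := right_extent (k := a) hc hd
      (fun p hp => by rcases h6 hp with h | h <;> linarith [h.1, h.2])
    have hw1 := left_extent (k := a) hc hd
      (fun p hp => by
        rcases h7 hp with h | h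
        · exact h.1.ge
        · exact le_of_lt h)
    have hab : ∀ t, k * (abs (c * |u₁ t| - d * |u₂ t|) / 2) ≤ (c * |u₁ t| + d * |u₂ t|) / 2 := by
      intro t
      have i1 : 0 ≤ c * |u₁ t| := by positivity
      have i2 : 0 ≤ d * |u₂ t| := by positivity
      have : abs (c * |u₁ t| - d * |u₂ t|) ≤ c * |u₁ t| + d * |u₂ t| := by
        rw [abs_le]; constructor <;> linarith
      nlinarith [abs_nonneg (c * |u₁ t| - d * |u₂ t|)]
    obtain ⟨t, ht⟩ := mem_range_of_exists_le_of_exists_ge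
      (f := fun t => z₁ t + k * (abs (c * |u₁ t| - d * |u₂ t|) / 2)) (c := a) (by fun_prop)
      ⟨0, by linarith [hab 0]⟩
      ⟨1, by
        have : 0 ≤ k * (abs (c * |u₁ 1| - d * |u₂ 1|) / 2) := by positivity
        have : 0 ≤ c * |u₁ 1| + d * |u₂ 1| := by positivity
        linarith⟩
    beta_reduce at ht
    have hL := left_extent (k := 0) hc hd (fun p hp => by
      rcases h8 t hp with (h | h) | (h | h)
      · rw [h.1]; exact ha.le
      · exact h.1.le
      · rw [h.1]; exact ha.le
      · exact (ha.trans h).le)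
    rw [zero_add] at hL
    have hdoor : ∀ p ∈ tiltedRect c d (z₁ t) (z₂ t) (u₁ t) (u₂ t),
        p 0 = a → 0 < p 1 ∧ p 1 < b := by
      intro p hp hpa
      rcases h8 t hp with (h | h) | (h | h)
      · exact h.2
      · exact absurd hpa h.2.ne
      · exact h.2
      · exact absurd hpa (ne_of_gt h)
    have hu : |u₁ t| ^ 2 + |u₂ t| ^ 2 = 1 := by rw [sq_abs, sq_abs]; exact h5 t
    rcases tiltedRect_eq_or c d (z₁ t) (z₂ t) (u₁ t) (u₂ t) with e | e <;> rw [e] at hdoor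
    · exact area_bound_of_door hb hc hd (abs_nonneg _) (abs_nonneg _) hu hk0 hk1 ht hL hdoor
    · rw [abs_sub_comm] at ht
      have := area_bound_of_door hb hd hc (abs_nonneg _) (abs_nonneg _) (by linarith) hk0 hk1 ht
        (by linarith) hdoor
      exact ⟨this.1.symm, by rw [mul_comm c d]; exact this.2⟩
  refine ⟨(main 0 le_rfl one_pos).1, ?_⟩
  -- Instead of a limit `k → 1`, the value `k = a b / (c d)` already gives a contradiction.
  by_contra! hlt
  have hp : 0 < c * d := by positivity
  have hab : 0 < a * b := by positivity
  have := (main (a * b / (c * d)) (by positivity) (by rwa [div_lt_one hp])).2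
  have e : c * d * (1 + a * b / (c * d)) = c * d + a * b := by field_simp
  linarith

/-! ### Positions that force the corner inequality -/

theorem unit_pos_of_corner_lt {a b c d C S : ℝ} (hC : 0 ≤ C) (hS : 0 ≤ S)
    (hCS : C ^ 2 + S ^ 2 = 1) (hda : d ≤ a) (hdb : d ≤ b)
    (h : a * S + b * C - c * S * C < d) : 0 < C ∧ 0 < S := by
  constructor
  · rcases hC.eq_or_lt with h0 | h0
    · rw [← h0] at hCS h
      have : S = 1 := by nlinarith
      rw [this] at h; linarith
    · exact h0
  · rcases hS.eq_or_lt with h0 | h0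
    · rw [← h0] at hCS h
      have : C = 1 := by nlinarith
      rw [this] at h; linarith
    · exact h0

/-- In the corridor with `x > 0` and `y > 0`, a rectangle part of which lies in the upper left arm
satisfies the corner inequality. -/
theorem corner_of_mem_upper {a b l w C S z₁ z₂ : ℝ} (hC : 0 < C) (hS : 0 < S)
    (hCS : C ^ 2 + S ^ 2 = 1) (hl : 0 < l) (hw : 0 < w)
    (hx : ∀ p ∈ tiltedRect l w z₁ z₂ C (-S), 0 ≤ p 0)
    (hy : ∀ p ∈ tiltedRect l w z₁ z₂ C (-S), 0 ≤ p 1)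
    (door : ∀ p ∈ tiltedRect l w z₁ z₂ C (-S), p 0 = a → p 1 < b)
    {q : Plane} (hq : q ∈ tiltedRect l w z₁ z₂ C (-S)) (hqa : q 0 < a) (hqb : b < q 1)
    (hwid : a < l * C + w * S) (hht : b < l * S + w * C) :
    w ≤ a * S + b * C - l * S * C := by
  have hL := left_extent hl hw hx
  have hB := bottom_extent hl hw hy
  rw [zero_add, abs_neg, abs_of_pos hC, abs_of_pos hS] at hL hB
  refine width_le_of_crossing hC hS hCS hw
    (fun s r hs hr => forall_mem_tiltedRect (P := fun x y => x = a → y < b) door hs hr) hL hB ?_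
    (by linarith)
  -- If the top vertex were beyond the door, the segment from `q` to a point near it would cross `x
  -- = a` above height `b`.
  by_contra! hT
  obtain ⟨s, r, hs, hr, h1, h2⟩ := exists_interior_near hl hw (σ := -(l / 2)) (ρ := w / 2)
    (by rw [abs_neg, abs_of_pos (by positivity)]) (by rw [abs_of_pos (by positivity)])
    (U := {x | a < z₁ + x.1 * C + x.2 * S} ∩ {x | b < z₂ - x.1 * S + x.2 * C})
    ((isOpen_lt (by fun_prop) (by fun_prop)).inter (isOpen_lt (by fun_prop) (by fun_prop)))
    ⟨by simp only [mem_ofPred_eq]; linarith, by simp only [mem_ofPred_eq]; linarith⟩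
  obtain ⟨m, hm, hma, hmb⟩ := exists_mem_between hq
    (q := !₂[z₁ + s * C + r * S, z₂ - s * S + r * C])
    ⟨s, r, hs, hr, by simp, by simp; ring⟩ hqa (by simpa using h1) hqb (by simpa using h2)
  exact absurd (door m hm hma) (not_lt.2 hmb.le)

/-- In the corridor with `x > 0` whose left arm has `y > 0`, a rectangle with centre in the left
arm, too large for the door at its tilt, satisfies the corner inequality. -/
theorem corner_of_center_lt {a b l w C S z₁ z₂ : ℝ} (hb : 0 < b) (hC : 0 < C) (hS : 0 < S)
    (hCS : C ^ 2 + S ^ 2 = 1) (hl : b * S < l) (hw : b * C < w)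
    (hx : ∀ p ∈ tiltedRect l w z₁ z₂ C (-S), 0 ≤ p 0)
    (hy : ∀ p ∈ tiltedRect l w z₁ z₂ C (-S), p 0 < a → 0 ≤ p 1)
    (door : ∀ p ∈ tiltedRect l w z₁ z₂ C (-S), p 0 = a → 0 < p 1 ∧ p 1 < b)
    (hz : z₁ ≤ a) (hwid : a < l * C + w * S) : w ≤ a * S + b * C - l * S * C := by
  have hl0 : 0 < l := (by positivity : 0 < b * S).trans hl
  have hw0 : 0 < w := (by positivity : 0 < b * C).trans hw
  have door' : ∀ s r : ℝ, |s| < l / 2 → |r| < w / 2 → z₁ + s * C + r * S = a →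
      0 < z₂ - s * S + r * C ∧ z₂ - s * S + r * C < b := fun s r hs hr =>
    forall_mem_tiltedRect (P := fun x y => x = a → 0 < y ∧ y < b) door hs hr
  have hL := left_extent hl0 hw0 hx
  rw [zero_add, abs_neg, abs_of_pos hC, abs_of_pos hS] at hL
  -- The centre is so far from the door that the top and bottom vertices are both in the left arm.
  have hch := chord_bound hC.le hS.le hCS hb hl hw door'
  rw [abs_of_nonneg (by linarith)] at hch
  have i1 := mul_lt_mul_of_pos_right hl hC
  have i2 := mul_lt_mul_of_pos_right hw hS
  have hB := affine_nonneg_of_local (k := z₂) (p := -S) (q := C) (k' := a - z₁) (p' := -C)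
    (q' := -S) (σ := l / 2) (ρ := -(w / 2)) hl0 hw0
    (fun s r hs hr h => by
      have := forall_mem_tiltedRect (P := fun x y => x < a → 0 ≤ y) hy hs hr (by linarith)
      linarith)
    (by rw [abs_of_pos (by positivity)]) (by rw [abs_neg, abs_of_pos (by positivity)])
    (by linarith)
  exact width_le_of_crossing hC hS hCS hw0 (fun s r hs hr h => (door' s r hs hr h).2) hL
    (by linarith) (by linarith) (by linarith)

/-- In the corridor with a full vertical and a half infinite horizontal strip, a sufficiently long
rectangle satisfies the corner inequality. -/
theorem corner_of_long {a b l w C S z₁ z₂ : ℝ} (hC : 0 < C) (hS : 0 < S)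
    (hCS : C ^ 2 + S ^ 2 = 1) (hl : 0 < l) (hw : 0 < w)
    (hx : ∀ p ∈ tiltedRect l w z₁ z₂ C (-S), 0 ≤ p 0)
    (hy : ∀ p ∈ tiltedRect l w z₁ z₂ C (-S), a ≤ p 0 → 0 < p 1 ∧ p 1 < b)
    (hlC : a < l * C) (hlS : b < l * S) : w ≤ a * S + b * C - l * S * C := by
  have hy' : ∀ s r : ℝ, |s| < l / 2 → |r| < w / 2 → a ≤ z₁ + s * C + r * S →
      0 < z₂ - s * S + r * C ∧ z₂ - s * S + r * C < b := fun s r hs hr =>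
    forall_mem_tiltedRect (P := fun x y => a ≤ x → 0 < y ∧ y < b) hy hs hr
  have hL := left_extent hl hw hx
  rw [zero_add, abs_neg, abs_of_pos hC, abs_of_pos hS] at hL
  have hwS : 0 < w * S := by positivity
  have hwC : 0 < w * C := by positivity
  have hB := affine_nonneg_of_local (k := z₂) (p := -S) (q := C) (k' := z₁ - a) (p' := C)
    (q' := S) (σ := l / 2) (ρ := -(w / 2)) hl hw
    (fun s r hs hr h => by linarith [(hy' s r hs hr (by linarith)).1])
    (by rw [abs_of_pos (by positivity)]) (by rw [abs_neg, abs_of_pos (by positivity)])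
    (by linarith)
  refine width_le_of_crossing hC hS hCS hw (fun s r hs hr h => (hy' s r hs hr h.ge).2) hL
    (by linarith) ?_ (by linarith)
  -- Otherwise the top and bottom vertices would both be in the horizontal strip, giving `l S + w C
  -- ≤ b`.
  by_contra! hT
  have := affine_nonneg_of_local (k := b - z₂) (p := S) (q := -C) (k' := z₁ - a) (p' := C)
    (q' := S) (σ := -(l / 2)) (ρ := w / 2) hl hw
    (fun s r hs hr h => by linarith [(hy' s r hs hr (by linarith)).2])
    (by rw [abs_neg, abs_of_pos (by positivity)]) (by rw [abs_of_pos (by positivity)])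
    (by linarith)
  linarith

/-! ### Motions cannot avoid the critical tilt -/

theorem forall_of_isOpen_cover {X : Type*} [TopologicalSpace X] [PreconnectedSpace X] {U V : Set X}
    (hU : IsOpen U) (hV : IsOpen V) (hd : ∀ x ∈ U, x ∉ V) (hc : ∀ x, x ∈ U ∨ x ∈ V) {x₀ : X}
    (h0 : x₀ ∈ U) (x : X) : x ∈ U :=
  isPreconnected_univ.subset_left_of_subset_union hU hV (disjoint_left.2 hd)
    (fun x _ => hc x) ⟨x₀, mem_univ _, h0⟩ (mem_univ x)

theorem isOpen_exists_mem_tiltedRect {c d : ℝ} {z₁ z₂ u₁ u₂ : unitInterval → ℝ}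
    (h1 : Continuous z₁) (h2 : Continuous z₂) (h3 : Continuous u₁) (h4 : Continuous u₂)
    {P : Set (ℝ × ℝ)} (hP : IsOpen P) :
    IsOpen {t | ∃ p ∈ tiltedRect c d (z₁ t) (z₂ t) (u₁ t) (u₂ t), (p 0, p 1) ∈ P} := by
  have e : {t | ∃ p ∈ tiltedRect c d (z₁ t) (z₂ t) (u₁ t) (u₂ t), (p 0, p 1) ∈ P} =
      ⋃ (s : ℝ) (r : ℝ) (_ : |s| < c / 2) (_ : |r| < d / 2),
        {t | (z₁ t + s * u₁ t - r * u₂ t, z₂ t + s * u₂ t + r * u₁ t) ∈ P} := by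
    ext t
    simp only [mem_ofPred_eq, mem_iUnion, exists_prop]
    constructor
    · rintro ⟨p, ⟨s, r, hs, hr, h0, h1⟩, hp⟩
      exact ⟨s, r, hs, hr, by rwa [← h0, ← h1]⟩
    · rintro ⟨s, r, hs, hr, hp⟩
      exact ⟨!₂[z₁ t + s * u₁ t - r * u₂ t, z₂ t + s * u₂ t + r * u₁ t],
        ⟨s, r, hs, hr, by simp, by simp⟩, by simpa using hp⟩
  rw [e]
  exact isOpen_iUnion fun s => isOpen_iUnion fun r => isOpen_iUnion fun _ => isOpen_iUnion fun _ =>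
    hP.preimage (by fun_prop)

theorem unit_snd_ge {C S C₀ S₀ : ℝ} (hC : 0 ≤ C) (hS : 0 ≤ S) (hCS : C ^ 2 + S ^ 2 = 1)
    (hCS₀ : C₀ ^ 2 + S₀ ^ 2 = 1) (h : C ≤ C₀) : S₀ ≤ S := by
  nlinarith

/-- At tilts with `|u₁| ≤ C₀` the rectangle is taller than `b`, so some of it is above the door, on
one side only. It starts like this on the left, and can leave that state only through `|u₁| = C₀`,
where `corner_of_mem_upper` contradicts the failing inequality. This corridor has no reflection
symmetry, so the opposite orientation is excluded through `corner_mirror`. -/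
theorem corner_of_canMove_quadrant {a b c d C₀ S₀ : ℝ} (ha : 0 < a) (hb : 0 < b) (hd : 0 < d)
    (hac : a < c) (hbc : b < c) (hda : d ≤ a) (hdb : d ≤ b) (hC₀ : 0 ≤ C₀) (hS₀ : 0 ≤ S₀)
    (hCS₀ : C₀ ^ 2 + S₀ ^ 2 = 1) (h : CanMove c d (armA1 a b) (armB1 a b)) :
    d ≤ a * S₀ + b * C₀ - c * S₀ * C₀ := by
  by_contra! hf
  obtain ⟨hC, hS⟩ := unit_pos_of_corner_lt hC₀ hS₀ hCS₀ hda hdb hf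
  have hc : 0 < c := ha.trans hac
  have hwid : a < c * C₀ + d * S₀ := by
    by_contra! hle
    exact absurd (corner_of_extent_le hC₀ hS₀ hCS₀ hd hdb hle) (not_le.2 hf)
  have hht : b < c * S₀ + d * C₀ := by
    by_contra! hle
    have := corner_of_extent_le hS₀ hC₀ (by linarith) hd hda hle
    linarith
  have hmir := corner_mirror hC₀ hS₀ hCS₀ hac.le hbc.le hda hdb hf
  obtain ⟨z₁, z₂, u₁, u₂, h1, h2, h3, h4, h5, h6, h7, h8⟩ := h
  have h5' : ∀ t, |u₁ t| ^ 2 + |u₂ t| ^ 2 = 1 := fun t => by rw [sq_abs, sq_abs]; exact h5 t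
  have hx : ∀ t, ∀ p ∈ tiltedRect c d (z₁ t) (z₂ t) (u₁ t) (u₂ t), 0 ≤ p 0 := by
    intro t p hp
    rcases h8 t hp with ⟨h | h, -⟩ | ⟨h | h, -⟩
    · rw [h.1]; exact ha.le
    · exact h.1.le
    · rw [h.1]; exact ha.le
    · exact (ha.trans h).le
  have hy : ∀ t, ∀ p ∈ tiltedRect c d (z₁ t) (z₂ t) (u₁ t) (u₂ t), 0 ≤ p 1 := by
    intro t p hp
    rcases h8 t hp with ⟨-, h⟩ | ⟨-, h⟩ <;> exact le_of_lt h
  have door : ∀ t, ∀ p ∈ tiltedRect c d (z₁ t) (z₂ t) (u₁ t) (u₂ t), p 0 = a → p 1 < b := by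
    intro t p hp hpa
    rcases h8 t hp with ⟨h | h, -⟩ | ⟨h | h, -⟩
    · exact h.2.2
    · exact absurd hpa h.2.ne
    · exact h.2.2
    · exact absurd hpa (ne_of_gt h)
  have high : ∀ t, |u₁ t| ≤ C₀ → ∃ p ∈ tiltedRect c d (z₁ t) (z₂ t) (u₁ t) (u₂ t), b < p 1 := by
    intro t ht
    by_contra! hle
    have i1 := top_extent hc hd hle
    have i2 := bottom_extent hc hd (hy t)
    have i3 := unit_snd_ge (abs_nonneg _) (abs_nonneg _) (h5' t) hCS₀ ht
    have := extent_gt_of_le hb (abs_nonneg (u₁ t)) hS₀ hC (by linarith [h5' t])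
      (by linarith : S₀ ^ 2 + C₀ ^ 2 = 1) i3 hbc hht
    linarith
  -- `U` is the initial state, `V` everything else. They are disjoint by convexity and cover all
  -- times because the critical tilt is impossible inside the upper left arm.
  let U : Set unitInterval := {t | |u₁ t| < C₀} ∩
    {t | ∃ p ∈ tiltedRect c d (z₁ t) (z₂ t) (u₁ t) (u₂ t), (p 0, p 1) ∈ Iio a ×ˢ Ioi b}
  let V : Set unitInterval := {t | C₀ < |u₁ t|} ∪
    {t | ∃ p ∈ tiltedRect c d (z₁ t) (z₂ t) (u₁ t) (u₂ t), (p 0, p 1) ∈ Ioi a ×ˢ Ioi b}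
  have hU : IsOpen U := (isOpen_lt (by fun_prop) (by fun_prop)).inter
    (isOpen_exists_mem_tiltedRect h1 h2 h3 h4 (isOpen_Iio.prod isOpen_Ioi))
  have hV : IsOpen V := (isOpen_lt (by fun_prop) (by fun_prop)).union
    (isOpen_exists_mem_tiltedRect h1 h2 h3 h4 (isOpen_Ioi.prod isOpen_Ioi))
  have hdisj : ∀ t ∈ U, t ∉ V := by
    rintro t ⟨hlt, p, hp, hpa, hpb⟩ (hgt | ⟨q, hq, hqa, hqb⟩)
    · exact lt_asymm (show |u₁ t| < C₀ from hlt) (show C₀ < |u₁ t| from hgt)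
    · obtain ⟨m, hm, hma, hmb⟩ := exists_mem_between hp hq hpa hqa hpb hqb
      exact absurd (door t m hm hma) (not_lt.2 hmb.le)
  have hcov : ∀ t, t ∈ U ∨ t ∈ V := by
    intro t
    rcases lt_or_ge C₀ |u₁ t| with hlt | hle
    · exact Or.inr (Or.inl hlt)
    obtain ⟨p, hp, hpb⟩ := high t hle
    rcases lt_trichotomy (p 0) a with hpa | hpa | hpa
    · rcases hle.lt_or_eq with hlt | heq
      · exact Or.inl ⟨hlt, p, hp, hpa, hpb⟩
      · exfalso
        have e2 : |u₂ t| = S₀ := by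
          have := h5' t
          rw [heq] at this
          nlinarith [abs_nonneg (u₂ t)]
        have hx := hx t
        have hy := hy t
        have door := door t
        rcases tiltedRect_eq_or c d (z₁ t) (z₂ t) (u₁ t) (u₂ t) with e | e <;>
          rw [e, heq, e2] at hx hy door hp
        · have := corner_of_mem_upper hC hS hCS₀ hc hd hx hy door hp hpa hpb hwid hht
          linarith
        · have := corner_of_mem_upper hS hC (by linarith) hd hc hx hy door hp hpa hpb
            (by linarith) (by linarith)
          linarith
    · exact absurd (door t p hp hpa) (not_lt.2 hpb.le)
    · exact Or.inr (Or.inr ⟨p, hp, hpa, hpb⟩)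
  have hr0 := right_extent (k := a) hc hd
    (fun p hp => by rcases (h6 hp).1 with h | h <;> linarith [h.1, h.2])
  have hl0 := left_extent hc hd (hx 0)
  have h0lt : |u₁ 0| < C₀ := by
    by_contra! hge
    have := extent_gt_of_le ha (abs_nonneg (u₂ 0)) hC₀ hS (h5' 0) hCS₀ hge hac hwid
    linarith
  have h0 : (0 : unitInterval) ∈ U := by
    obtain ⟨p, hp, hpb⟩ := high 0 h0lt.le
    refine ⟨h0lt, p, hp, ?_, hpb⟩
    rcases (h6 hp).1 with h | h
    · exact absurd h.2.2 (not_lt.2 hpb.le)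
    · exact h.2
  obtain ⟨-, p, hp, hpa, hpb⟩ := forall_of_isOpen_cover hU hV hdisj hcov h0 1
  rcases (h7 hp).1 with h | h
  · exact absurd h.1 (ne_of_lt hpa)
  · exact lt_asymm (show p 0 < a from hpa) (show a < p 0 from h)

/-- The connectedness argument now uses the side of `x = a` on which the centre lies. Since `d ≥ h`,
a failing tilt has `b C₀ < d`, so for `|u₁| ≤ C₀` the central chords are too long for the centre to
cross the door. -/
theorem corner_of_canMove_halfPlane {a b c d C₀ S₀ : ℝ} (ha : 0 < a) (hb : 0 < b) (hd : 0 < d)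
    (hac : a < c) (hbc : b < c) (hda : d ≤ a) (hdb : d ≤ b) (hcd : c * d ≤ a * b)
    (hh : a ^ 2 * b ^ 2 ≤ d ^ 2 * (a ^ 2 + b ^ 2)) (hC₀ : 0 ≤ C₀) (hS₀ : 0 ≤ S₀)
    (hCS₀ : C₀ ^ 2 + S₀ ^ 2 = 1) (h : CanMove c d (armA1 a b) (armB0 a b)) :
    d ≤ a * S₀ + b * C₀ - c * S₀ * C₀ := by
  by_contra! hf
  obtain ⟨hC, hS⟩ := unit_pos_of_corner_lt hC₀ hS₀ hCS₀ hda hdb hf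
  have hc : 0 < c := ha.trans hac
  have hwid : a < c * C₀ + d * S₀ := by
    by_contra! hle
    exact absurd (corner_of_extent_le hC₀ hS₀ hCS₀ hd hdb hle) (not_le.2 hf)
  have hbC : b * C₀ < d := by
    by_contra! hle
    exact absurd (corner_of_high hb hC₀ hS₀ hCS₀ hd hcd hh hle) (not_le.2 hf)
  have hmir := corner_mirror hC₀ hS₀ hCS₀ hac.le hbc.le hda hdb hf
  obtain ⟨z₁, z₂, u₁, u₂, h1, h2, h3, h4, h5, h6, h7, h8⟩ := h
  have h5' : ∀ t, |u₁ t| ^ 2 + |u₂ t| ^ 2 = 1 := fun t => by rw [sq_abs, sq_abs]; exact h5 t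
  have hx : ∀ t, ∀ p ∈ tiltedRect c d (z₁ t) (z₂ t) (u₁ t) (u₂ t), 0 ≤ p 0 := by
    intro t p hp
    rcases h8 t hp with ⟨h | h, -⟩ | (h | h)
    · rw [h.1]; exact ha.le
    · exact h.1.le
    · rw [h.1]; exact ha.le
    · exact (ha.trans h).le
  have hy : ∀ t, ∀ p ∈ tiltedRect c d (z₁ t) (z₂ t) (u₁ t) (u₂ t), p 0 < a → 0 ≤ p 1 := by
    intro t p hp hpa
    rcases h8 t hp with ⟨-, h⟩ | (h | h)
    · exact le_of_lt h
    · exact h.2.1.le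
    · exact absurd h (not_lt.2 hpa.le)
  have door : ∀ t, ∀ p ∈ tiltedRect c d (z₁ t) (z₂ t) (u₁ t) (u₂ t),
      p 0 = a → 0 < p 1 ∧ p 1 < b := by
    intro t p hp hpa
    rcases h8 t hp with ⟨h | h, -⟩ | (h | h)
    · exact h.2
    · exact absurd hpa h.2.ne
    · exact h.2
    · exact absurd hpa (ne_of_gt h)
  have center_ne : ∀ t, |u₁ t| ≤ C₀ → z₁ t ≠ a := by
    intro t ht hz
    have hu1 : |u₂ t| ≤ 1 := by nlinarith [h5' t, abs_nonneg (u₂ t)]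
    have j1 : b * |u₁ t| < d := by nlinarith
    have j2 : b * |u₂ t| < c := by nlinarith
    have p0 : 0 < |u₂ t| := by
      have := unit_snd_ge (abs_nonneg _) (abs_nonneg _) (h5' t) hCS₀ ht
      linarith
    have i1 := mul_lt_mul_of_pos_right j1 p0
    have i2 := mul_le_mul_of_nonneg_right j2.le (abs_nonneg (u₁ t))
    have door := door t
    rcases tiltedRect_eq_or c d (z₁ t) (z₂ t) (u₁ t) (u₂ t) with e | e <;> rw [e] at door
    · have := chord_bound (abs_nonneg _) (abs_nonneg _) (h5' t) hb j2 j1 (fun s r hs hr =>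
        forall_mem_tiltedRect (P := fun x y => x = a → 0 < y ∧ y < b) door hs hr)
      rw [hz, sub_self, abs_zero] at this
      linarith
    · have := chord_bound (abs_nonneg _) (abs_nonneg _) (by linarith [h5' t]) hb j1 j2
        (fun s r hs hr =>
          forall_mem_tiltedRect (P := fun x y => x = a → 0 < y ∧ y < b) door hs hr)
      rw [hz, sub_self, abs_zero] at this
      linarith
  have hdisj : ∀ t ∈ {t | |u₁ t| < C₀} ∩ {t | z₁ t < a}, t ∉ {t | C₀ < |u₁ t|} ∪ {t | a < z₁ t} := by
    rintro t ⟨hlt, hz⟩ (hgt | hz')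
    · exact lt_asymm (show |u₁ t| < C₀ from hlt) (show C₀ < |u₁ t| from hgt)
    · exact lt_asymm (show z₁ t < a from hz) (show a < z₁ t from hz')
  have hcov : ∀ t, t ∈ {t | |u₁ t| < C₀} ∩ {t | z₁ t < a} ∨
      t ∈ {t | C₀ < |u₁ t|} ∪ {t | a < z₁ t} := by
    intro t
    rcases lt_or_ge C₀ |u₁ t| with hlt | hle
    · exact Or.inr (Or.inl hlt)
    rcases lt_trichotomy (z₁ t) a with hz | hz | hz
    · rcases hle.lt_or_eq with hlt | heq
      · exact Or.inl ⟨hlt, hz⟩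
      · exfalso
        have e2 : |u₂ t| = S₀ := by
          have := h5' t
          rw [heq] at this
          nlinarith [abs_nonneg (u₂ t)]
        have hx := hx t
        have hy := hy t
        have door := door t
        have hS1 : S₀ ≤ 1 := by nlinarith
        rcases tiltedRect_eq_or c d (z₁ t) (z₂ t) (u₁ t) (u₂ t) with e | e <;>
          rw [e, heq, e2] at hx hy door
        · have := corner_of_center_lt hb hC hS hCS₀ (by nlinarith) hbC hx hy door hz.le hwid
          linarith
        · have := corner_of_center_lt hb hS hC (by linarith) hbC (by nlinarith) hx hy door hz.le
            (by linarith)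
          linarith
    · exact absurd hz (center_ne t hle)
    · exact Or.inr (Or.inr hz)
  have hr0 := right_extent (k := a) hc hd
    (fun p hp => by rcases (h6 hp).1 with h | h <;> linarith [h.1, h.2])
  have hl0 := left_extent hc hd (hx 0)
  have hl1 := left_extent (k := a) hc hd (fun p hp => by
    rcases h7 hp with h | h
    · exact h.1.ge
    · exact le_of_lt h)
  have h0lt : |u₁ 0| < C₀ := by
    by_contra! hge
    have := extent_gt_of_le ha (abs_nonneg (u₂ 0)) hC₀ hS (h5' 0) hCS₀ hge hac hwid
    linarith
  have hz0 : z₁ 0 ≤ a := by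
    have : 0 ≤ c * |u₁ 0| + d * |u₂ 0| := by positivity
    linarith
  obtain ⟨-, hz1⟩ := forall_of_isOpen_cover
    ((isOpen_lt (by fun_prop) (by fun_prop)).inter (isOpen_lt (by fun_prop) (by fun_prop)))
    ((isOpen_lt (by fun_prop) (by fun_prop)).union (isOpen_lt (by fun_prop) (by fun_prop)))
    hdisj hcov (x₀ := (0 : unitInterval)) ⟨h0lt, lt_of_le_of_ne hz0 (center_ne 0 h0lt.le)⟩ 1
  have : 0 ≤ c * |u₁ 1| + d * |u₂ 1| := by positivity
  exact absurd (show z₁ 1 < a from hz1) (by linarith)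

/-- Since `d ≤ h`, a failing tilt has `c C₀ > a` and `c S₀ > b`. The width of the first arm and the
height of the second then put `|u₁|` on opposite sides of `C₀` at the two ends of the motion. -/
theorem corner_of_canMove_strip {a b c d C₀ S₀ : ℝ} (ha : 0 < a) (hb : 0 < b) (hc : 0 < c)
    (hd : 0 < d) (hda : d ≤ a) (hdb : d ≤ b) (hcd : c * d ≤ a * b)
    (hh : d ^ 2 * (a ^ 2 + b ^ 2) ≤ a ^ 2 * b ^ 2) (hC₀ : 0 ≤ C₀) (hS₀ : 0 ≤ S₀)
    (hCS₀ : C₀ ^ 2 + S₀ ^ 2 = 1) (h : CanMove c d (armA0 a b) (armB3 a b)) :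
    d ≤ a * S₀ + b * C₀ - c * S₀ * C₀ := by
  by_contra! hf
  obtain ⟨hC, hS⟩ := unit_pos_of_corner_lt hC₀ hS₀ hCS₀ hda hdb hf
  have hcC : a < c * C₀ := by
    by_contra! hle
    exact absurd (corner_of_low ha hb hC₀ hS₀ hCS₀ hd hcd hh hle) (not_le.2 hf)
  have hcS : b < c * S₀ := by
    by_contra! hle
    have := corner_of_low hb ha hS₀ hC₀ (by linarith) hd (by linarith) (by linarith) hle
    linarith
  obtain ⟨z₁, z₂, u₁, u₂, h1, h2, h3, h4, h5, h6, h7, h8⟩ := h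
  have h5' : ∀ t, |u₁ t| ^ 2 + |u₂ t| ^ 2 = 1 := fun t => by rw [sq_abs, sq_abs]; exact h5 t
  have hx : ∀ t, ∀ p ∈ tiltedRect c d (z₁ t) (z₂ t) (u₁ t) (u₂ t), 0 ≤ p 0 := by
    intro t p hp
    rcases h8 t hp with (h | h) | ⟨h | h, -⟩
    · rw [h.1]; exact ha.le
    · exact h.1.le
    · rw [h.1]; exact ha.le
    · exact (ha.trans h).le
  have hy : ∀ t, ∀ p ∈ tiltedRect c d (z₁ t) (z₂ t) (u₁ t) (u₂ t),
      a ≤ p 0 → 0 < p 1 ∧ p 1 < b := by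
    intro t p hp hpa
    rcases h8 t hp with (h | h) | ⟨-, h⟩
    · exact h.2
    · exact absurd h.2 (not_lt.2 hpa)
    · exact h
  have hr0 := right_extent (k := a) hc hd
    (fun p hp => by rcases h6 hp with h | h <;> linarith [h.1, h.2])
  have hl0 := left_extent hc hd (hx 0)
  have hb1 := bottom_extent (k := 0) hc hd (fun p hp => (h7 hp).2.1.le)
  have ht1 := top_extent (k := b) hc hd (fun p hp => (h7 hp).2.2.le)
  have h0 : |u₁ 0| ≤ C₀ := by
    by_contra! hlt
    have : 0 ≤ d * |u₂ 0| := by positivity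
    nlinarith
  have h1' : C₀ ≤ |u₁ 1| := by
    by_contra! hlt
    have i3 := unit_snd_ge (abs_nonneg _) (abs_nonneg _) (h5' 1) hCS₀ hlt.le
    have : 0 ≤ d * |u₁ 1| := by positivity
    nlinarith
  obtain ⟨t, heq⟩ := mem_range_of_exists_le_of_exists_ge (f := fun t => |u₁ t|) (c := C₀)
    (by fun_prop) ⟨0, h0⟩ ⟨1, h1'⟩
  beta_reduce at heq
  have e2 : |u₂ t| = S₀ := by
    have := h5' t
    rw [heq] at this
    nlinarith [abs_nonneg (u₂ t)]
  -- The constraints are invariant under `y ↦ b - y`, so the long axis may be taken to point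
  -- downwards without exchanging the sides.
  obtain ⟨y, hrect⟩ : ∃ y, tiltedRect c d (z₁ t) y C₀ (-S₀) ⊆
      {p | 0 ≤ p 0 ∧ (a ≤ p 0 → 0 < p 1 ∧ p 1 < b)} := by
    have hsub : tiltedRect c d (z₁ t) (z₂ t) (u₁ t) (u₂ t) ⊆
        {p | 0 ≤ p 0 ∧ (a ≤ p 0 → 0 < p 1 ∧ p 1 < b)} := fun p hp => ⟨hx t p hp, hy t p hp⟩
    rcases le_total (u₁ t * u₂ t) 0 with hs | hs
    · rw [tiltedRect_eq_of_mul_nonpos hs, heq, e2] at hsub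
      exact ⟨_, hsub⟩
    · have := tiltedRect_reflect_subset (b := b)
        (A' := {p | 0 ≤ p 0 ∧ (a ≤ p 0 → 0 < p 1 ∧ p 1 < b)})
        (fun p hp => ⟨by simpa using hp.1, by
          intro hpa
          have := hp.2 (by simpa using hpa)
          simp only [Matrix.cons_val_one, Matrix.cons_val_zero]
          constructor <;> linarith⟩) hsub
      rw [tiltedRect_eq_of_mul_nonpos (by linarith), abs_neg, heq, e2] at this
      exact ⟨_, this⟩
  have := corner_of_long hC hS hCS₀ hc hd (fun p hp => (hrect hp).1) (fun p hp => (hrect hp).2)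
    hcC hcS
  linarith

/-! ### Turning about the corner `(a, 0)` -/

/-- The rectangle with long direction `(C, S)` whose leftmost corner is on `x = 0` and whose lower
side is on a line through `(a, 0)`, translated by `τ (C, S)`. -/
def pivotRect (a c d C S τ : ℝ) : Set Plane :=
  tiltedRect c d (c * C / 2 + d * S / 2 + τ * C)
    ((d - a * S) / C + c * S / 2 - d * C / 2 + τ * S) C S

theorem exists_of_mem_pivotRect {a c d C S τ : ℝ} (hC : 0 < C) (hCS : C ^ 2 + S ^ 2 = 1)
    {p : Plane} (hp : p ∈ pivotRect a c d C S τ) :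
    ∃ s r : ℝ, τ < s ∧ s < τ + c ∧ 0 < r ∧ r < d ∧ p 0 = s * C + r * S ∧
      p 1 = (d - a * S) / C + s * S - r * C ∧ C * p 1 = d - r + S * (p 0 - a) := by
  obtain ⟨s, r, hs, hr, h0, h1⟩ := hp
  rw [abs_lt] at hs hr
  have e0 : p 0 = (s + c / 2 + τ) * C + (d / 2 - r) * S := by rw [h0]; ring
  have e1 : p 1 = (d - a * S) / C + (s + c / 2 + τ) * S - (d / 2 - r) * C := by rw [h1]; ring
  refine ⟨s + c / 2 + τ, d / 2 - r, by linarith, by linarith, by linarith, by linarith, e0, e1, ?_⟩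
  rw [e1, e0]
  field_simp
  linear_combination -(d - 2 * r) * hCS

theorem pivotRect_pos {a c d C S τ : ℝ} (hC : 0 < C) (hS : 0 ≤ S) (hCS : C ^ 2 + S ^ 2 = 1)
    (hτ : 0 ≤ τ) {p : Plane} (hp : p ∈ pivotRect a c d C S τ) :
    0 < p 0 ∧ (a ≤ p 0 → 0 < p 1) := by
  obtain ⟨s, r, h1, h2, h3, h4, h5, h6, h7⟩ := exists_of_mem_pivotRect hC hCS hp
  have hs : 0 < s := hτ.trans_lt h1
  refine ⟨by rw [h5]; positivity, fun hpa => ?_⟩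
  have : 0 ≤ S * (p 0 - a) := mul_nonneg hS (by linarith)
  exact pos_of_mul_pos_right (by linarith : 0 < C * p 1) hC.le

/-- All of the rectangle is below `y = b` if the corner inequality holds. -/
theorem pivotRect_below {a b c d C S : ℝ} (hC : 0 < C) (hS : 0 ≤ S) (hCS : C ^ 2 + S ^ 2 = 1)
    (h : d ≤ a * S + b * C - c * S * C) {p : Plane} (hp : p ∈ pivotRect a c d C S 0) :
    p 1 < b := by
  obtain ⟨s, r, h1, h2, h3, h4, h5, h6, h7⟩ := exists_of_mem_pivotRect hC hCS hp
  have e : (d - a * S) / C ≤ b - c * S := by rw [div_le_iff₀ hC]; linarith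
  have : 0 < r * C := by positivity
  nlinarith

/-- The protruding part is below `y = b`. -/
theorem pivotRect_right_below {a b c d C S : ℝ} (hC : 0 < C) (hS : 0 < S)
    (hCS : C ^ 2 + S ^ 2 = 1) (h : d * S + c * C ≤ a + b * S * C) {p : Plane}
    (hp : p ∈ pivotRect a c d C S 0) (hpa : a ≤ p 0) : p 1 < b := by
  obtain ⟨s, r, h1, h2, h3, h4, h5, h6, h7⟩ := exists_of_mem_pivotRect hC hCS hp
  -- The right end side bounds `C x + S y`; on `x ≥ a` the resulting bound for `y` is weakest at `x
  -- = a`.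
  have e : C * p 0 + S * p 1 = S * ((d - a * S) / C) + s := by
    rw [h5, h6]; linear_combination s * hCS
  have e' : S * ((d - a * S) / C) * C = S * (d - a * S) := by field_simp
  have key : S * C * p 1 < S * C * b := by
    have : C * (C * p 0 + S * p 1) < S * (d - a * S) + c * C := by rw [e]; nlinarith
    have : C ^ 2 * a ≤ C ^ 2 * p 0 := by gcongr
    have : C ^ 2 * a + S ^ 2 * a = a := by rw [← add_mul, hCS, one_mul]
    nlinarith
  exact lt_of_mul_lt_mul_left key (by positivity)

/-- The part in the left arm is below `y = b` if the vertical chords are at most `b`. -/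
theorem pivotRect_left_below {a b c d C S τ : ℝ} (hC : 0 < C) (hS : 0 ≤ S)
    (hCS : C ^ 2 + S ^ 2 = 1) (h : d ≤ b * C) {p : Plane} (hp : p ∈ pivotRect a c d C S τ)
    (hpa : p 0 ≤ a ∨ S = 0) : p 1 < b := by
  obtain ⟨s, r, h1, h2, h3, h4, h5, h6, h7⟩ := exists_of_mem_pivotRect hC hCS hp
  have : S * (p 0 - a) ≤ 0 := by
    rcases hpa with h | h
    · exact mul_nonpos_of_nonneg_of_nonpos hS (by linarith)
    · rw [h, zero_mul]
  exact lt_of_mul_lt_mul_left (by linarith : C * p 1 < C * b) hC.le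

/-- The rectangle starts nearly vertical inside the left arm, turns until its direction has first
coordinate `C₁`, and then slides along that direction. The starting position reaches far down, so
arms bounded by `y > 0` on the left are treated by reflection. -/
theorem canMove_of_pivotRect {a c d C₁ : ℝ} (ha : 0 < a) (hc : 0 < c) (hd : 0 < d) (hda : d < a)
    (hC₁ : 0 < C₁) (hC₁' : C₁ ≤ 1) {A B : Set Plane}
    (hA : ∀ p ∈ A ∪ B, p 0 < a → p ∈ A) (hB : ∀ p ∈ A ∪ B, a < p 0 → p ∈ B)
    (hrot : ∀ C S : ℝ, 0 < C → C ≤ C₁ → 0 ≤ S → C ^ 2 + S ^ 2 = 1 →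
      pivotRect a c d C S 0 ⊆ A ∪ B)
    (htrans : ∀ S τ : ℝ, 0 ≤ S → C₁ ^ 2 + S ^ 2 = 1 → 0 ≤ τ → pivotRect a c d C₁ S τ ⊆ A ∪ B) :
    CanMove c d A B := by
  -- Chosen so that the initial width is at most `c C₀ + d ≤ a`.
  set C₀ := min C₁ ((a - d) / c) with hC₀
  have hC₀pos : 0 < C₀ := lt_min hC₁ (div_pos (by linarith) hc)
  have hC₀le : C₀ ≤ C₁ := min_le_left _ _
  have hcC₀ : c * C₀ ≤ a - d := by
    have := (le_div_iff₀ hc).1 (min_le_right C₁ ((a - d) / c))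
    linarith
  let C : unitInterval → ℝ := fun t => C₀ + min (2 * (t : ℝ)) 1 * (C₁ - C₀)
  let S : unitInterval → ℝ := fun t => √(1 - C t ^ 2)
  -- The final shift `a / C₁` moves the leftmost corner from `x = 0` to `x = a`.
  let τ : unitInterval → ℝ := fun t => max 0 (2 * (t : ℝ) - 1) * (a / C₁)
  have hCcont : Continuous C := by fun_prop
  have hScont : Continuous S := by fun_prop
  have hτcont : Continuous τ := by fun_prop
  have hCpos : ∀ t, 0 < C t := fun t => by
    have : 0 ≤ min (2 * (t : ℝ)) 1 := le_min (by linarith [t.2.1]) zero_le_one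
    have := mul_nonneg this (sub_nonneg.2 hC₀le)
    simp only [C]; linarith
  have hCle : ∀ t, C t ≤ C₁ := fun t => by
    have : min (2 * (t : ℝ)) 1 ≤ 1 := min_le_right _ _
    simp only [C]; nlinarith
  have hSnn : ∀ t, 0 ≤ S t := fun t => sqrt_nonneg _
  have hCS : ∀ t, C t ^ 2 + S t ^ 2 = 1 := fun t => by
    have : 0 ≤ 1 - C t ^ 2 := by nlinarith [hCpos t, hCle t]
    simp only [S]; rw [sq_sqrt this]; ring
  have hmem : ∀ t, pivotRect a c d (C t) (S t) (τ t) ⊆ A ∪ B := by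
    intro t
    rcases le_total (2 * (t : ℝ)) 1 with h | h
    · have e : τ t = 0 := by simp only [τ]; rw [max_eq_left (by linarith), zero_mul]
      rw [e]
      exact hrot _ _ (hCpos t) (hCle t) (hSnn t) (hCS t)
    · have e : C t = C₁ := by simp only [C]; rw [min_eq_right h]; ring
      have := hCS t
      rw [e] at this ⊢
      exact htrans _ _ (hSnn t) this (mul_nonneg (le_max_left _ _) (by positivity))
  refine ⟨fun t => c * C t / 2 + d * S t / 2 + τ t * C t,
    fun t => (d - a * S t) / C t + c * S t / 2 - d * C t / 2 + τ t * S t, C, S, by fun_prop, ?_,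
    hCcont, hScont, hCS, ?_, ?_, hmem⟩
  · have : Continuous fun t => (d - a * S t) / C t :=
      (by fun_prop : Continuous fun t => d - a * S t).div hCcont fun t => (hCpos t).ne'
    fun_prop
  · intro p hp
    have hp' : p ∈ pivotRect a c d (C 0) (S 0) (τ 0) := hp
    refine hA p (hmem 0 hp) ?_
    obtain ⟨s, r, h1, h2, h3, h4, h5, -, -⟩ := exists_of_mem_pivotRect (hCpos 0) (hCS 0) hp'
    have eτ : τ 0 = 0 := by simp [τ]
    have eC : C 0 = C₀ := by simp [C]
    rw [eτ] at h1 h2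
    have hS1 : S 0 ≤ 1 := by nlinarith [hCS 0, hSnn 0, sq_nonneg (C 0)]
    have i1 : s * C 0 < c * C 0 := by have := hCpos 0; gcongr; linarith
    have i2 : r * S 0 ≤ d * 1 := by have := hSnn 0; gcongr
    rw [eC] at i1 h5
    linarith
  · intro p hp
    have hp' : p ∈ pivotRect a c d (C 1) (S 1) (τ 1) := hp
    refine hB p (hmem 1 hp) ?_
    obtain ⟨s, r, h1, h2, h3, h4, h5, -, -⟩ := exists_of_mem_pivotRect (hCpos 1) (hCS 1) hp'
    have eτ : τ 1 = a / C₁ := by simp only [τ]; norm_num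
    have eC : C 1 = C₁ := by simp only [C]; norm_num
    have i1 : τ 1 * C 1 < s * C 1 := by have := hCpos 1; gcongr
    have i2 : 0 ≤ r * S 1 := mul_nonneg h3.le (hSnn 1)
    have e : τ 1 * C 1 = a := by rw [eτ, eC]; field_simp
    linarith

/-- A rectangle that fits into an axis parallel `a × b` box can be translated through the door. -/
theorem canMove_of_fits {a b c d u₁ u₂ : ℝ} (ha : 0 < a) (hu : u₁ ^ 2 + u₂ ^ 2 = 1)
    (hx : ∀ s r : ℝ, |s| < c / 2 → |r| < d / 2 → |s * u₁ - r * u₂| < a / 2)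
    (hy : ∀ s r : ℝ, |s| < c / 2 → |r| < d / 2 → |s * u₂ + r * u₁| < b / 2) :
    CanMove c d (armA1 a b) (armB3 a b) := by
  have key : ∀ t : ℝ, ∀ p ∈ tiltedRect c d (a / 2 + t * a) (b / 2) u₁ u₂,
      t * a < p 0 ∧ p 0 < a + t * a ∧ 0 < p 1 ∧ p 1 < b := by
    rintro t p ⟨s, r, hs, hr, e0, e1⟩
    have h1 := abs_lt.1 (hx s r hs hr)
    have h2 := abs_lt.1 (hy s r hs hr)
    refine ⟨?_, ?_, ?_, ?_⟩ <;> linarith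
  refine ⟨fun t => a / 2 + t * a, fun _ => b / 2, fun _ => u₁, fun _ => u₂, by fun_prop,
    by fun_prop, by fun_prop, by fun_prop, fun _ => hu, ?_, ?_, ?_⟩
  · intro p hp
    obtain ⟨h1, h2, h3, h4⟩ := key _ p hp
    simp only [Icc.coe_zero, zero_mul, add_zero] at h1 h2
    exact ⟨Or.inr ⟨h1, h2⟩, h3⟩
  · intro p hp
    obtain ⟨h1, h2, h3, h4⟩ := key _ p hp
    simp only [Icc.coe_one, one_mul] at h1
    exact ⟨Or.inr h1, h3, h4⟩
  · intro t p hp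
    obtain ⟨h1, h2, h3, h4⟩ := key _ p hp
    have : 0 ≤ t * a := mul_nonneg t.2.1 ha.le
    rcases lt_trichotomy (p 0) a with h | h | h
    · exact Or.inl ⟨Or.inr ⟨by linarith, h⟩, h3⟩
    · exact Or.inl ⟨Or.inl ⟨h, h3, h4⟩, h3⟩
    · exact Or.inr ⟨Or.inr h, h3, h4⟩

/-! ### Algebraic forms of `m` and `h` -/

theorem le_cornerMin_iff {a b c d : ℝ} :
    d ≤ cornerMin a b c ↔ ∀ C S : ℝ, 0 ≤ C → 0 ≤ S → C ^ 2 + S ^ 2 = 1 →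
      d ≤ a * S + b * C - c * S * C := by
  rw [le_isGLB_iff (cornerMin_isLeast a b c).isGLB]
  constructor
  · intro h C S hC hS hCS
    have hS1 : S ≤ 1 := by nlinarith
    refine h ⟨arcsin S, ⟨arcsin_nonneg.2 hS, arcsin_le_pi_div_two S⟩, ?_⟩
    rw [cornerFun, sin_arcsin (by linarith) hS1, cos_arcsin]
    have : √(1 - S ^ 2) = C := by rw [← hCS, add_sub_cancel_right, sqrt_sq hC]
    rw [this]
  · rintro h _ ⟨t, ⟨ht0, ht1⟩, rfl⟩
    exact h (cos t) (sin t) (cos_nonneg_of_mem_Icc ⟨by linarith, ht1⟩)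
      (sin_nonneg_of_nonneg_of_le_pi ht0 (by linarith [pi_pos])) (cos_sq_add_sin_sq t)

theorem cornerHeight_le_iff {a b d : ℝ} (ha : 0 < a) (hb : 0 < b) (hd : 0 < d) :
    cornerHeight a b ≤ d ↔ a ^ 2 * b ^ 2 ≤ d ^ 2 * (a ^ 2 + b ^ 2) := by
  have hD : 0 < a ^ 2 + b ^ 2 := by positivity
  rw [cornerHeight, div_le_iff₀ (sqrt_pos.2 hD), ← mul_pow,
    ← pow_le_pow_iff_left₀ (by positivity) (by positivity) two_ne_zero, mul_pow d, sq_sqrt hD.le]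

theorem le_cornerHeight_iff {a b d : ℝ} (ha : 0 < a) (hb : 0 < b) (hd : 0 < d) :
    d ≤ cornerHeight a b ↔ d ^ 2 * (a ^ 2 + b ^ 2) ≤ a ^ 2 * b ^ 2 := by
  have hD : 0 < a ^ 2 + b ^ 2 := by positivity
  rw [cornerHeight, le_div_iff₀ (sqrt_pos.2 hD), ← mul_pow,
    ← pow_le_pow_iff_left₀ (by positivity) (by positivity) two_ne_zero, mul_pow d, sq_sqrt hD.le]

theorem cornerHeight_le_min {a b : ℝ} (ha : 0 < a) (hb : 0 < b) :
    cornerHeight a b ≤ min a b := by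
  refine le_min ?_ ?_
  · rw [cornerHeight_le_iff ha hb ha]; nlinarith [sq_nonneg (a ^ 2)]
  · rw [cornerHeight_le_iff ha hb hb]; nlinarith [sq_nonneg (b ^ 2)]

theorem le_min_of_le_cornerMin {a b c d : ℝ} (h : d ≤ cornerMin a b c) : d ≤ min a b := by
  rw [le_cornerMin_iff] at h
  have h1 := h 0 1 le_rfl zero_le_one (by norm_num)
  have h2 := h 1 0 zero_le_one le_rfl (by norm_num)
  exact le_min (by linarith) (by linarith)

theorem lt_of_le_cornerMin {a b c d : ℝ} (ha : 0 < a) (hb : 0 < b) (hbc : b < c)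
    (h : d ≤ cornerMin a b c) : d < a := by
  have hc : 0 < c := hb.trans hbc
  -- Any `S` with `b / c < S < 1` works: there `b C < c S C`, so the corner function is below `a S <
  -- a`.
  set S := (b / c + 1) / 2 with hS
  have hbc' : b / c < 1 := (div_lt_one hc).2 hbc
  have hbc0 : 0 < b / c := by positivity
  have hS0 : 0 < S := by linarith
  have hS1 : S < 1 := by linarith
  have hbS : b < c * S := by
    have : b / c < S := by linarith
    rw [div_lt_iff₀ hc] at this; linarith
  have hpos : 0 < 1 - S ^ 2 := by nlinarith
  have hC : 0 < √(1 - S ^ 2) := sqrt_pos.2 hpos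
  have := le_cornerMin_iff.1 h (√(1 - S ^ 2)) S hC.le hS0.le (by rw [sq_sqrt hpos.le]; ring)
  nlinarith

/-! ### Constructing the motions -/

theorem canMove_of_le_max {a b c d : ℝ} (ha : 0 < a) (hc : c ≤ max a b)
    (hd : d ≤ min a b) : CanMove c d (armA1 a b) (armB3 a b) := by
  have hda := hd.trans (min_le_left _ _)
  have hdb := hd.trans (min_le_right _ _)
  rcases le_max_iff.1 hc with h | h
  · refine canMove_of_fits (u₁ := 1) (u₂ := 0) ha (by norm_num) (fun s r hs hr => ?_)
      (fun s r hs hr => ?_)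
    · simp only [mul_one, mul_zero, sub_zero]; linarith
    · simp only [mul_one, mul_zero, zero_add]; linarith
  · refine canMove_of_fits (u₁ := 0) (u₂ := 1) ha (by norm_num) (fun s r hs hr => ?_)
      (fun s r hs hr => ?_)
    · simp only [mul_one, mul_zero, zero_sub, abs_neg]; linarith
    · simp only [mul_one, mul_zero, add_zero]; linarith

theorem lt_of_area_le {a b c d : ℝ} (hb : 0 < b) (hd : 0 < d) (hbc : b < c)
    (hcd : c * d ≤ a * b) : d < a := by
  by_contra! h
  nlinarith [mul_lt_mul_of_pos_right hbc hd, mul_le_mul_of_nonneg_left h hb.le]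

/-- After multiplication by `d` and with `c d ≤ a b`, the claim reduces to `(d - b C)(a - d S) ≥ 0`.
-/
theorem protrusion_le {a b c d C S : ℝ} (hd : 0 < d) (hda : d ≤ a) (hC : 0 ≤ C) (hS : 0 ≤ S)
    (hCS : C ^ 2 + S ^ 2 = 1) (hcd : c * d ≤ a * b) (h : b * C ≤ d) :
    d * S + c * C ≤ a + b * S * C := by
  have hS1 : S ≤ 1 := by nlinarith
  have h1 : 0 ≤ (d - b * C) * (a - d * S) := mul_nonneg (by linarith) (by nlinarith)
  have h2 : 0 ≤ d * (a + b * S * C - (d * S + c * C)) := by nlinarith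
  linarith [nonneg_of_mul_nonneg_right h2 hd]

theorem canMove_A0B1 {a b c d : ℝ} (ha : 0 < a) (hb : 0 < b) (hd : 0 < d) (hac : a < c)
    (hbc : b < c) (hcd : c * d ≤ a * b) : CanMove c d (armA0 a b) (armB1 a b) := by
  have hda := lt_of_area_le hb hd hbc hcd
  have hdb : d < b := lt_of_area_le ha hd hac (by linarith)
  have hmem : ∀ p : Plane, 0 < p 0 ∧ (a ≤ p 0 → 0 < p 1) → (p 0 = a → p 1 < b) →
      p ∈ armA0 a b ∪ armB1 a b := by
    rintro p ⟨h0, h1⟩ h2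
    rcases lt_trichotomy (p 0) a with h | h | h
    · exact Or.inl (Or.inr ⟨h0, h⟩)
    · exact Or.inl (Or.inl ⟨h, h1 h.ge, h2 h⟩)
    · exact Or.inr ⟨Or.inr h, h1 h.le⟩
  have hbd : b * (d / b) = d := by field_simp
  -- At `C = d / b` the vertical chord `d / C` equals the height of the door, so from this tilt on
  -- the rectangle can slide through.
  refine canMove_of_pivotRect (C₁ := d / b) ha (ha.trans hac) hd hda (by positivity)
    ((div_le_one hb).2 hdb.le) ?_ ?_ ?_ ?_
  · rintro p (hp | ⟨hp | hp, -⟩) hpa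
    · exact hp
    · exact absurd hp.1 hpa.ne
    · exact absurd (show a < p 0 from hp) (not_lt.2 hpa.le)
  · rintro p ((hp | hp) | hp) hpa
    · exact absurd hp.1 hpa.ne'
    · exact absurd hp.2 (not_lt.2 hpa.le)
    · exact hp
  · intro C S hC hC₁ hS hCS p hp
    have hbC : b * C ≤ d := by rw [← hbd]; gcongr
    have hS0 : 0 < S := hS.lt_of_ne' fun h0 => by
      rw [h0] at hCS
      have : C = 1 := by nlinarith
      rw [this] at hbC; linarith
    exact hmem p (pivotRect_pos hC hS hCS le_rfl hp) fun hpa =>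
      pivotRect_right_below hC hS0 hCS (protrusion_le hd hda.le hC.le hS hCS hcd hbC) hp hpa.ge
  · intro S τ hS hCS hτ p hp
    have hC : 0 < d / b := by positivity
    exact hmem p (pivotRect_pos hC hS hCS hτ hp) fun hpa =>
      pivotRect_left_below hC hS hCS hbd.ge hp (Or.inl hpa.le)

theorem canMove_A0B3 {a b c d : ℝ} (ha : 0 < a) (hb : 0 < b) (hd : 0 < d) (hac : a < c)
    (hbc : b < c) (hcd : c * d ≤ a * b) (hh : a ^ 2 * b ^ 2 ≤ d ^ 2 * (a ^ 2 + b ^ 2)) :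
    CanMove c d (armA0 a b) (armB3 a b) := by
  have hda := lt_of_area_le hb hd hbc hcd
  have hdb : d < b := lt_of_area_le ha hd hac (by linarith)
  have hmem : ∀ p : Plane, 0 < p 0 ∧ (a ≤ p 0 → 0 < p 1) → (a ≤ p 0 → p 1 < b) →
      p ∈ armA0 a b ∪ armB3 a b := by
    rintro p ⟨h0, h1⟩ h2
    rcases lt_trichotomy (p 0) a with h | h | h
    · exact Or.inl (Or.inr ⟨h0, h⟩)
    · exact Or.inl (Or.inl ⟨h, h1 h.ge, h2 h.ge⟩)
    · exact Or.inr ⟨Or.inr h, h1 h.le, h2 h.le⟩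
  refine canMove_of_pivotRect (C₁ := 1) ha (ha.trans hac) hd hda one_pos le_rfl ?_ ?_ ?_ ?_
  · rintro p (hp | ⟨hp | hp, -⟩) hpa
    · exact hp
    · exact absurd hp.1 hpa.ne
    · exact absurd (show a < p 0 from hp) (not_lt.2 hpa.le)
  · rintro p ((hp | hp) | hp) hpa
    · exact absurd hp.1 hpa.ne'
    · exact absurd hp.2 (not_lt.2 hpa.le)
    · exact hp
  · intro C S hC hC₁ hS hCS p hp
    refine hmem p (pivotRect_pos hC hS hCS le_rfl hp) fun hpa => ?_
    have hS0 : C < 1 → 0 < S := fun hlt => hS.lt_of_ne' fun h0 => by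
      rw [h0] at hCS
      nlinarith
    rcases le_total (b * C) d with hbC | hbC
    · exact pivotRect_right_below hC (hS0 (by nlinarith)) hCS
        (protrusion_le hd hda.le hC.le hS hCS hcd hbC) hp hpa
    rcases le_total (c * C) a with hcC | hcC
    · exact pivotRect_right_below hC (hS0 (by nlinarith)) hCS (by nlinarith) hp hpa
    · exact pivotRect_below hC hS hCS (corner_of_high hb hC.le hS hCS hd hcd hh hbC) hp
  · intro S τ hS hCS hτ p hp
    have hS0 : S = 0 := by nlinarith
    exact hmem p (pivotRect_pos one_pos hS hCS hτ hp) fun _ =>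
      pivotRect_left_below one_pos hS hCS (by linarith) hp (Or.inr hS0)

/-- Turning stops at `C = d / b`, so `c C ≤ c d / b ≤ a` throughout and `corner_of_low` keeps the
whole rectangle below `b`. The motion is built between the mirror images of the arms. -/
theorem canMove_A1B2 {a b c d : ℝ} (ha : 0 < a) (hb : 0 < b) (hd : 0 < d) (hac : a < c)
    (hbc : b < c) (hcd : c * d ≤ a * b) (hh : d ^ 2 * (a ^ 2 + b ^ 2) ≤ a ^ 2 * b ^ 2) :
    CanMove c d (armA1 a b) (armB2 a b) := by
  have hda := lt_of_area_le hb hd hbc hcd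
  have hdb : d < b := lt_of_area_le ha hd hac (by linarith)
  have hmem : ∀ p : Plane, 0 < p 0 ∧ (a ≤ p 0 → 0 < p 1) → (p 0 ≤ a → p 1 < b) →
      p ∈ (armA0 a b ∩ {p | p 1 < b}) ∪ armB1 a b := by
    rintro p ⟨h0, h1⟩ h2
    rcases lt_trichotomy (p 0) a with h | h | h
    · exact Or.inl ⟨Or.inr ⟨h0, h⟩, h2 h.le⟩
    · exact Or.inl ⟨Or.inl ⟨h, h1 h.ge, h2 h.le⟩, h2 h.le⟩
    · exact Or.inr ⟨Or.inr h, h1 h.le⟩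
  have hbd : b * (d / b) = d := by field_simp
  have hC₀ : 0 < d / b := by positivity
  have key : CanMove c d (armA0 a b ∩ {p | p 1 < b}) (armB1 a b) := by
    refine canMove_of_pivotRect (C₁ := d / b) ha (ha.trans hac) hd hda hC₀
      ((div_le_one hb).2 hdb.le) ?_ ?_ ?_ ?_
    · rintro p (hp | ⟨hp | hp, -⟩) hpa
      · exact hp
      · exact absurd hp.1 hpa.ne
      · exact absurd (show a < p 0 from hp) (not_lt.2 hpa.le)
    · rintro p (⟨hp | hp, -⟩ | hp) hpa
      · exact absurd hp.1 hpa.ne'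
      · exact absurd hp.2 (not_lt.2 hpa.le)
      · exact hp
    · intro C S hC hC₁ hS hCS p hp
      have hcC : c * C ≤ a := by
        have h1 : c * C ≤ c * (d / b) := by have := ha.trans hac; gcongr
        have h2 : c * (d / b) ≤ a := by rw [← mul_div_assoc, div_le_iff₀ hb]; exact hcd
        linarith
      exact hmem p (pivotRect_pos hC hS hCS le_rfl hp) fun _ =>
        pivotRect_below hC hS hCS (corner_of_low ha hb hC.le hS hCS hd hcd hh hcC) hp
    · intro S τ hS hCS hτ p hp
      exact hmem p (pivotRect_pos hC₀ hS hCS hτ hp) fun hpa =>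
        pivotRect_left_below hC₀ hS hCS hbd.ge hp (Or.inl hpa)
  refine key.reflect (b := b) ?_ ?_
  · rintro p ⟨hp | hp, hpb⟩
    · exact ⟨Or.inl ⟨hp.1, sub_pos.2 hp.2.2, sub_lt_self _ hp.2.1⟩, show 0 < b - p 1 from sub_pos.2 hpb⟩
    · exact ⟨Or.inr hp, show 0 < b - p 1 from sub_pos.2 hpb⟩
  · rintro p ⟨hp | hp, hpb⟩
    · exact ⟨Or.inl ⟨hp.1, sub_pos.2 hp.2.2, sub_lt_self _ hp.2.1⟩, sub_lt_self b hpb⟩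
    · exact ⟨Or.inr hp, sub_lt_self b hpb⟩

theorem canMove_A1B3 {a b c d : ℝ} (ha : 0 < a) (hb : 0 < b) (hd : 0 < d) (hac : a < c)
    (hbc : b < c) (hm : d ≤ cornerMin a b c) : CanMove c d (armA1 a b) (armB3 a b) := by
  have hda := lt_of_le_cornerMin ha hb hbc hm
  have hdb := (le_min_of_le_cornerMin hm).trans (min_le_right _ _)
  have hmem : ∀ p : Plane, 0 < p 0 ∧ (a ≤ p 0 → 0 < p 1) → p 1 < b →
      p ∈ (armA0 a b ∩ {p | p 1 < b}) ∪ armB3 a b := by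
    rintro p ⟨h0, h1⟩ h2
    rcases lt_trichotomy (p 0) a with h | h | h
    · exact Or.inl ⟨Or.inr ⟨h0, h⟩, h2⟩
    · exact Or.inl ⟨Or.inl ⟨h, h1 h.ge, h2⟩, h2⟩
    · exact Or.inr ⟨Or.inr h, h1 h.le, h2⟩
  have key : CanMove c d (armA0 a b ∩ {p | p 1 < b}) (armB3 a b) := by
    refine canMove_of_pivotRect (C₁ := 1) ha (ha.trans hac) hd hda one_pos le_rfl ?_ ?_ ?_ ?_
    · rintro p (hp | ⟨hp | hp, -⟩) hpa
      · exact hp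
      · exact absurd hp.1 hpa.ne
      · exact absurd (show a < p 0 from hp) (not_lt.2 hpa.le)
    · rintro p (⟨hp | hp, -⟩ | hp) hpa
      · exact absurd hp.1 hpa.ne'
      · exact absurd hp.2 (not_lt.2 hpa.le)
      · exact hp
    · intro C S hC hC₁ hS hCS p hp
      exact hmem p (pivotRect_pos hC hS hCS le_rfl hp)
        (pivotRect_below hC hS hCS (le_cornerMin_iff.1 hm C S hC.le hS hCS) hp)
    · intro S τ hS hCS hτ p hp
      have hS0 : S = 0 := by nlinarith
      exact hmem p (pivotRect_pos one_pos hS hCS hτ hp)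
        (pivotRect_left_below one_pos hS hCS (by linarith) hp (Or.inr hS0))
  refine key.reflect (b := b) ?_ ?_
  · rintro p ⟨hp | hp, hpb⟩
    · exact ⟨Or.inl ⟨hp.1, sub_pos.2 hp.2.2, sub_lt_self _ hp.2.1⟩, show 0 < b - p 1 from sub_pos.2 hpb⟩
    · exact ⟨Or.inr hp, show 0 < b - p 1 from sub_pos.2 hpb⟩
  · rintro p ⟨hp | hp, hpb⟩
    · exact ⟨Or.inl ⟨hp.1, sub_pos.2 hp.2.2, sub_lt_self _ hp.2.1⟩, sub_pos.2 hpb.2,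
        sub_lt_self b hpb.1⟩
    · exact ⟨Or.inr hp, sub_pos.2 hpb.2, sub_lt_self b hpb.1⟩

/-! ### Characterisation of the movable rectangles -/

theorem armA1_subset (a b : ℝ) : armA1 a b ⊆ armA0 a b := inter_subset_left

theorem armB1_subset (a b : ℝ) : armB1 a b ⊆ armB0 a b := inter_subset_left

theorem armB2_subset (a b : ℝ) : armB2 a b ⊆ armB0 a b := inter_subset_left

theorem armB3_subset_armB0 (a b : ℝ) : armB3 a b ⊆ armB0 a b := inter_subset_left

theorem armB3_subset_armB1 (a b : ℝ) : armB3 a b ⊆ armB1 a b := fun _ h => ⟨h.1, h.2.1⟩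

theorem armB3_subset_armB2 (a b : ℝ) : armB3 a b ⊆ armB2 a b := fun _ h => ⟨h.1, h.2.2⟩

theorem le_left_of_canMove {a b c d : ℝ} (ha : 0 < a) (hd : 0 < d) (hdc : d ≤ c)
    (h : CanMove c d (armA0 a b) (armB0 a b)) : d ≤ a := by
  obtain ⟨z₁, z₂, u₁, u₂, -, -, -, -, h5, h6, -, -⟩ := h
  have hc : 0 < c := hd.trans_le hdc
  have hr := right_extent (k := a) hc hd
    (fun p hp => by rcases h6 hp with h | h <;> linarith [h.1, h.2])
  have hl := left_extent (k := 0) hc hd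
    (fun p hp => by rcases h6 hp with h | h <;> linarith [h.1, h.2])
  -- The horizontal width `c |u₁| + d |u₂|` is at least `d (|u₁| + |u₂|) ≥ d`.
  have h1 : 1 ≤ |u₁ 0| + |u₂ 0| := by
    have := h5 0
    rw [← sq_abs, ← sq_abs (u₂ 0)] at this
    nlinarith [abs_nonneg (u₁ 0), abs_nonneg (u₂ 0)]
  have h2 : d * |u₁ 0| ≤ c * |u₁ 0| := by gcongr
  nlinarith

theorem bounds_of_canMove {a b c d : ℝ} (ha : 0 < a) (hb : 0 < b) (hd : 0 < d) (hdc : d ≤ c)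
    (h : CanMove c d (armA0 a b) (armB0 a b)) : d ≤ min a b ∧ c * d ≤ a * b := by
  have h1 := area_le_of_canMove ha hb (hd.trans_le hdc) hd h
  exact ⟨le_min (le_left_of_canMove ha hd hdc h) (h1.1.elim id hdc.trans), h1.2⟩

theorem canMove_A0B1_of_bounds {a b c d : ℝ} (ha : 0 < a) (hb : 0 < b) (hd : 0 < d)
    (h : d ≤ min a b ∧ c * d ≤ a * b) : CanMove c d (armA0 a b) (armB1 a b) := by
  rcases le_or_gt c (max a b) with hc | hc
  · exact (canMove_of_le_max ha hc h.1).mono (armA1_subset a b) (armB3_subset_armB1 a b)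
  · rw [max_lt_iff] at hc
    exact canMove_A0B1 ha hb hd hc.1 hc.2 h.2

theorem CanMove.A0B2_of_A0B1 {a b c d : ℝ} (h : CanMove c d (armA0 a b) (armB1 a b)) :
    CanMove c d (armA0 a b) (armB2 a b) := by
  refine h.reflect (b := b) ?_ ?_
  · rintro p (hp | hp)
    · exact Or.inl ⟨hp.1, sub_pos.2 hp.2.2, sub_lt_self _ hp.2.1⟩
    · exact Or.inr hp
  · rintro p ⟨hp | hp, hpb⟩
    · exact ⟨Or.inl ⟨hp.1, sub_pos.2 hp.2.2, sub_lt_self _ hp.2.1⟩, sub_lt_self b hpb⟩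
    · exact ⟨Or.inr hp, sub_lt_self b hpb⟩

theorem canMove_A1B3_of {a b c d : ℝ} (ha : 0 < a) (hb : 0 < b) (hd : 0 < d)
    (h : (c ≤ max a b ∧ d ≤ min a b) ∨ d ≤ cornerMin a b c) :
    CanMove c d (armA1 a b) (armB3 a b) := by
  rcases h with ⟨h1, h2⟩ | h
  · exact canMove_of_le_max ha h1 h2
  rcases le_or_gt c (max a b) with hc | hc
  · exact canMove_of_le_max ha hc (le_min_of_le_cornerMin h)
  · rw [max_lt_iff] at hc
    exact canMove_A1B3 ha hb hd hc.1 hc.2 h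

theorem canMove_A0_iff {a b c d : ℝ} (ha : 0 < a) (hb : 0 < b) (hd : 0 < d) (hdc : d ≤ c)
    {j : Fin 4} (hj : j ∈ ({0, 1, 2} : Set (Fin 4))) :
    CanMove c d (armA a b 0) (armB a b j) ↔ d ≤ min a b ∧ c * d ≤ a * b := by
  constructor
  · intro h
    refine bounds_of_canMove ha hb hd hdc (h.mono subset_rfl ?_)
    rcases hj with rfl | rfl | rfl
    exacts [subset_rfl, armB1_subset a b, armB2_subset a b]
  · intro h
    have h1 := canMove_A0B1_of_bounds ha hb hd h
    rcases hj with rfl | rfl | rfl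
    exacts [h1.mono subset_rfl (armB1_subset a b), h1, h1.A0B2_of_A0B1]

theorem canMove_A0B3_iff {a b c d : ℝ} (ha : 0 < a) (hb : 0 < b) (hd : 0 < d) (hdc : d ≤ c) :
    CanMove c d (armA0 a b) (armB3 a b) ↔
      (cornerHeight a b ≤ d ∧ d ≤ min a b ∧ c * d ≤ a * b) ∨
        d ≤ min (cornerHeight a b) (cornerMin a b c) := by
  constructor
  · intro h
    have h1 := bounds_of_canMove ha hb hd hdc (h.mono subset_rfl (armB3_subset_armB0 a b))
    rcases le_total (cornerHeight a b) d with hh | hh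
    · exact Or.inl ⟨hh, h1⟩
    · refine Or.inr (le_min hh (le_cornerMin_iff.2 fun C S hC hS hCS => ?_))
      exact corner_of_canMove_strip ha hb (hd.trans_le hdc) hd (h1.1.trans (min_le_left _ _))
        (h1.1.trans (min_le_right _ _)) h1.2 ((le_cornerHeight_iff ha hb hd).1 hh) hC hS hCS h
  · rintro (⟨hh, h1, h2⟩ | h)
    · rcases le_or_gt c (max a b) with hc | hc
      · exact (canMove_of_le_max ha hc h1).mono (armA1_subset a b) subset_rfl
      · rw [max_lt_iff] at hc
        exact canMove_A0B3 ha hb hd hc.1 hc.2 h2 ((cornerHeight_le_iff ha hb hd).1 hh)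
    · exact (canMove_A1B3_of ha hb hd (Or.inr (h.trans (min_le_right _ _)))).mono
        (armA1_subset a b) subset_rfl

theorem canMove_A1B0_iff {a b c d : ℝ} (ha : 0 < a) (hb : 0 < b) (hd : 0 < d) (hdc : d ≤ c)
    {j : Fin 4} (hj : j ∈ ({0, 2} : Set (Fin 4))) :
    CanMove c d (armA a b 1) (armB a b j) ↔
      (d ≤ cornerHeight a b ∧ c * d ≤ a * b) ∨
      (cornerHeight a b ≤ d ∧ d ≤ min a b ∧ c ≤ max a b) ∨
      (cornerHeight a b ≤ d ∧ d ≤ cornerMin a b c) := by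
  constructor
  · intro h'
    have h : CanMove c d (armA1 a b) (armB0 a b) := by
      rcases hj with rfl | rfl
      exacts [h', h'.mono subset_rfl (armB2_subset a b)]
    have h1 := bounds_of_canMove ha hb hd hdc (h.mono (armA1_subset a b) subset_rfl)
    rcases le_total d (cornerHeight a b) with hh | hh
    · exact Or.inl ⟨hh, h1.2⟩
    rcases le_or_gt c (max a b) with hc | hc
    · exact Or.inr (Or.inl ⟨hh, h1.1, hc⟩)
    · rw [max_lt_iff] at hc
      refine Or.inr (Or.inr ⟨hh, le_cornerMin_iff.2 fun C S hC hS hCS => ?_⟩)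
      exact corner_of_canMove_halfPlane ha hb hd hc.1 hc.2 (h1.1.trans (min_le_left _ _))
        (h1.1.trans (min_le_right _ _)) h1.2 ((cornerHeight_le_iff ha hb hd).1 hh) hC hS hCS h
  · intro h
    have h2 : CanMove c d (armA1 a b) (armB2 a b) := by
      rcases h with ⟨hh, h1⟩ | ⟨-, h1, hc⟩ | ⟨-, hm⟩
      · rcases le_or_gt c (max a b) with hc | hc
        · exact (canMove_of_le_max ha hc (hh.trans (cornerHeight_le_min ha hb))).mono subset_rfl
            (armB3_subset_armB2 a b)
        · rw [max_lt_iff] at hc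
          exact canMove_A1B2 ha hb hd hc.1 hc.2 h1 ((le_cornerHeight_iff ha hb hd).1 hh)
      · exact (canMove_of_le_max ha hc h1).mono subset_rfl (armB3_subset_armB2 a b)
      · exact (canMove_A1B3_of ha hb hd (Or.inr hm)).mono subset_rfl (armB3_subset_armB2 a b)
    rcases hj with rfl | rfl
    exacts [h2.mono subset_rfl (armB2_subset a b), h2]

theorem canMove_A1B1_iff {a b c d : ℝ} (ha : 0 < a) (hb : 0 < b) (hd : 0 < d) (hdc : d ≤ c)
    {j : Fin 4} (hj : j ∈ ({1, 3} : Set (Fin 4))) :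
    CanMove c d (armA a b 1) (armB a b j) ↔
      (c ≤ max a b ∧ d ≤ min a b) ∨ d ≤ cornerMin a b c := by
  constructor
  · intro h'
    have h : CanMove c d (armA1 a b) (armB1 a b) := by
      rcases hj with rfl | rfl
      exacts [h', h'.mono subset_rfl (armB3_subset_armB1 a b)]
    have h1 := bounds_of_canMove ha hb hd hdc (h.mono (armA1_subset a b) (armB1_subset a b))
    rcases le_or_gt c (max a b) with hc | hc
    · exact Or.inl ⟨hc, h1.1⟩
    · rw [max_lt_iff] at hc
      refine Or.inr (le_cornerMin_iff.2 fun C S hC hS hCS => ?_)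
      exact corner_of_canMove_quadrant ha hb hd hc.1 hc.2 (h1.1.trans (min_le_left _ _))
        (h1.1.trans (min_le_right _ _)) hC hS hCS h
  · intro h
    have h2 := canMove_A1B3_of ha hb hd h
    rcases hj with rfl | rfl
    exacts [h2.mono subset_rfl (armB3_subset_armB1 a b), h2]

/-- The side lengths can be ordered by `IsOpenRectangle.symm`, so comparing the sets for `d ≤ c`
suffices. -/
theorem eq_of_rectangles {X Y : Set (Set Plane)}
    (hX : ∀ R ∈ X, ∃ c d, IsOpenRectangle c d R) (hY : ∀ R ∈ Y, ∃ c d, IsOpenRectangle c d R)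
    (h : ∀ c d R, d ≤ c → IsOpenRectangle c d R → (R ∈ X ↔ R ∈ Y)) : X = Y := by
  have key : ∀ R, (∃ c d, IsOpenRectangle c d R) → (R ∈ X ↔ R ∈ Y) := by
    rintro R ⟨c, d, hR⟩
    rcases le_total d c with hdc | hcd
    exacts [h c d R hdc hR, h d c R hcd hR.symm]
  ext R
  exact ⟨fun hR => (key R (hX R hR)).1 hR, fun hR => (key R (hY R hR)).2 hR⟩

/-- At height `h` the area bound gives the corner inequality. -/
theorem le_cornerMin_of_eq_cornerHeight {a b c d : ℝ} (ha : 0 < a) (hb : 0 < b) (hd : 0 < d)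
    (hh : d = cornerHeight a b) (hcd : c * d ≤ a * b) : d ≤ cornerMin a b c := by
  refine le_cornerMin_iff.2 fun C S hC hS hCS => ?_
  rcases le_total d (b * C) with h | h
  · exact corner_of_high hb hC hS hCS hd hcd ((cornerHeight_le_iff ha hb hd).1 hh.ge) h
  · refine corner_of_low ha hb hC hS hCS hd hcd ((le_cornerHeight_iff ha hb hd).1 hh.le) ?_
    have h1 : c * d * C ≤ a * b * C := by gcongr
    have h2 : a * (b * C) ≤ a * d := by gcongr
    exact le_of_mul_le_mul_right (by linarith : c * C * d ≤ a * d) hd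

end

theorem theorem1 (a b : ℝ) (ha : 0 < a) (hb : 0 < b) :
    (movableRectangles a b 0 0 = movableRectangles a b 0 1 ∧
      movableRectangles a b 0 1 = movableRectangles a b 0 2) ∧
    movableRectangles a b 1 0 = movableRectangles a b 1 2 ∧
    movableRectangles a b 1 1 = movableRectangles a b 1 3 ∧
    movableRectangles a b 0 0 = movableRectangles a b 1 0 ∪ movableRectangles a b 0 3 ∧
    movableRectangles a b 1 3 = movableRectangles a b 1 0 ∩ movableRectangles a b 0 3 ∧
    ∀ (c d : ℝ) (R : Set Plane), d ≤ c → IsOpenRectangle c d R →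
      (∀ j ∈ ({0, 1, 2} : Set (Fin 4)),
        (R ∈ movableRectangles a b 0 j ↔ d ≤ min a b ∧ c * d ≤ a * b)) ∧
      (R ∈ movableRectangles a b 0 3 ↔
        (cornerHeight a b ≤ d ∧ d ≤ min a b ∧ c * d ≤ a * b) ∨
        d ≤ min (cornerHeight a b) (cornerMin a b c)) ∧
      (∀ j ∈ ({0, 2} : Set (Fin 4)),
        (R ∈ movableRectangles a b 1 j ↔
          (d ≤ cornerHeight a b ∧ c * d ≤ a * b) ∨
          (cornerHeight a b ≤ d ∧ d ≤ min a b ∧ c ≤ max a b) ∨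
          (cornerHeight a b ≤ d ∧ d ≤ cornerMin a b c))) ∧
      (∀ j ∈ ({1, 3} : Set (Fin 4)),
        (R ∈ movableRectangles a b 1 j ↔
          (c ≤ max a b ∧ d ≤ min a b) ∨ d ≤ cornerMin a b c)) := by
  have char : ∀ (c d : ℝ) (R : Set Plane), d ≤ c → IsOpenRectangle c d R →
      (∀ j ∈ ({0, 1, 2} : Set (Fin 4)),
        (R ∈ movableRectangles a b 0 j ↔ d ≤ min a b ∧ c * d ≤ a * b)) ∧
      (R ∈ movableRectangles a b 0 3 ↔
        (cornerHeight a b ≤ d ∧ d ≤ min a b ∧ c * d ≤ a * b) ∨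
        d ≤ min (cornerHeight a b) (cornerMin a b c)) ∧
      (∀ j ∈ ({0, 2} : Set (Fin 4)),
        (R ∈ movableRectangles a b 1 j ↔
          (d ≤ cornerHeight a b ∧ c * d ≤ a * b) ∨
          (cornerHeight a b ≤ d ∧ d ≤ min a b ∧ c ≤ max a b) ∨
          (cornerHeight a b ≤ d ∧ d ≤ cornerMin a b c))) ∧
      (∀ j ∈ ({1, 3} : Set (Fin 4)),
        (R ∈ movableRectangles a b 1 j ↔
          (c ≤ max a b ∧ d ≤ min a b) ∨ d ≤ cornerMin a b c)) := by
    intro c d R hdc hR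
    have hd : 0 < d := hR.2.1
    simp only [mem_movableRectangles_iff hR]
    exact ⟨fun j hj => canMove_A0_iff ha hb hd hdc hj, canMove_A0B3_iff ha hb hd hdc,
      fun j hj => canMove_A1B0_iff ha hb hd hdc hj, fun j hj => canMove_A1B1_iff ha hb hd hdc hj⟩
  have hrect : ∀ i j, ∀ R ∈ movableRectangles a b i j, ∃ c d, IsOpenRectangle c d R :=
    fun i j R hR => hR.1
  refine ⟨⟨?_, ?_⟩, ?_, ?_, ?_, ?_, char⟩
  · refine eq_of_rectangles (hrect _ _) (hrect _ _) fun c d R hdc hR => ?_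
    obtain ⟨h, -⟩ := char c d R hdc hR
    exact (h 0 (by simp)).trans (h 1 (by simp)).symm
  · refine eq_of_rectangles (hrect _ _) (hrect _ _) fun c d R hdc hR => ?_
    obtain ⟨h, -⟩ := char c d R hdc hR
    exact (h 1 (by simp)).trans (h 2 (by simp)).symm
  · refine eq_of_rectangles (hrect _ _) (hrect _ _) fun c d R hdc hR => ?_
    obtain ⟨-, -, h, -⟩ := char c d R hdc hR
    exact (h 0 (by simp)).trans (h 2 (by simp)).symm
  · refine eq_of_rectangles (hrect _ _) (hrect _ _) fun c d R hdc hR => ?_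
    obtain ⟨-, -, -, h⟩ := char c d R hdc hR
    exact (h 1 (by simp)).trans (h 3 (by simp)).symm
  · refine eq_of_rectangles (hrect _ _) (fun R hR => hR.elim (hrect _ _ R) (hrect _ _ R))
      fun c d R hdc hR => ?_
    have hd : 0 < d := hR.2.1
    obtain ⟨h0, h3, h1, -⟩ := char c d R hdc hR
    constructor
    · intro h
      obtain ⟨i1, i2⟩ := (h0 0 (by simp)).1 h
      rcases le_total d (cornerHeight a b) with hh | hh
      · exact Or.inl ((h1 0 (by simp)).2 (Or.inl ⟨hh, i2⟩))
      · exact Or.inr (h3.2 (Or.inl ⟨hh, i1, i2⟩))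
    · rintro (h | h)
      · exact (mem_movableRectangles_iff hR 0 0).2
          (((mem_movableRectangles_iff hR 1 0).1 h).mono (armA1_subset a b) subset_rfl)
      · exact (mem_movableRectangles_iff hR 0 0).2
          (((mem_movableRectangles_iff hR 0 3).1 h).mono subset_rfl (armB3_subset_armB0 a b))
  · refine eq_of_rectangles (hrect _ _) (fun R hR => hrect _ _ R hR.1) fun c d R hdc hR => ?_
    have hd : 0 < d := hR.2.1
    obtain ⟨-, h3, h1, h13⟩ := char c d R hdc hR
    constructor
    · intro h
      have h' := (mem_movableRectangles_iff hR 1 3).1 h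
      exact ⟨(mem_movableRectangles_iff hR 1 0).2 (h'.mono subset_rfl (armB3_subset_armB0 a b)),
        (mem_movableRectangles_iff hR 0 3).2 (h'.mono (armA1_subset a b) subset_rfl)⟩
    · rintro ⟨h, h'⟩
      rw [h13 3 (by simp)]
      rcases (h1 0 (by simp)).1 h with ⟨hh, hcd⟩ | ⟨-, i1, i2⟩ | ⟨-, i⟩
      -- Here `d ≤ h`, and the first alternative for the strip gives `d ≥ h`, so `d = h`.
      · rcases h3.1 h' with ⟨hh', -⟩ | i
        · exact Or.inr (le_cornerMin_of_eq_cornerHeight ha hb hd (le_antisymm hh hh') hcd)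
        · exact Or.inr (i.trans (min_le_right _ _))
      · exact Or.inl ⟨i2, i1⟩
      · exact Or.inr i
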